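/- Let $\bar M$ be a compact smooth manifold with boundary, of dimension $m=d+1$, let $g$ be an asymptotically hyperbolic metric on its interior $M$ and $x$ a special boundary defining function: $\bar g=x^2g$ extends to a continuous Riemannian metric on $\bar M$, and $|dx|_{\bar g}=1$ on a neighbourhood of $\partial M$. Let $(x,y_1,\dots,y_d)$ be coordinates on an open subset of $\bar M$ (smooth in the interior, $C^1$ up to the boundary) whose first coordinate is $x$ and in which $\bar g(\partial_s,\partial_x)=\delta_{sx}$ throughout (for example normal coordinates on $\partial M$ extended along the $\bar g$-geodesics normal to $\partial M$). Let $D\subset[0,\infty)\times\mathbb R^d$ be the image of the chart, $\partial D=\{y:(0,y)\in D\}$, and consider the frame $X_s=x\partial_s$. A function $f$ on $D\cap\{x>0\}$ is called polyhomogeneous (phg) if it is smooth and there are $k_0\in\mathbb Z$, $p_k\in\mathbb N$ and $a_{k,p}\in C^\infty(\partial D)$ with $$f\sim\sum_{k\ge k_0}\sum_{p=0}^{p_k}a_{k,p}(y)\,x^k\log^p x ,$$ in the sense that for every $N\in\mathbb Z$ the difference of $f$ and the sum of the terms with $k\le N$ is, together with all its iterated derivatives along $x\partial_x,\partial_{y_1},\dots,\partial_{y_d}$,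 of order $O(x^N)$ as $x\to0$, locally uniformly in $y\in\partial D$. (Put $a_{k,p}=0$ for the pairs $(k,p)$ that do not occur.) Suppose that all components $\bar g_{st}=\bar g(\partial_s,\partial_t)$ are phg and continuous up to the boundary, that is, on $D$. Then: (1) For every $p\ge0$, every component with respect to the frame $X_s$ of the $p$-th covariant derivative $\nabla^pR$ of the curvature tensor of $g$, with any of its indices raised or lowered by $g$, is phg and extends continuously to $D$. (2) For every $n\in\mathbb Z$ the terms below $x^n$ in the expansion of any such component are determined by the terms below $x^n$ in the expansion of $\bar g$, locally on the boundary: let $g'$, $x'$ be another metric and special boundary defining function, on a possibly different manifold of the same dimension, with coordinates of the same kind in which $\bar g'=x'^2g'$ satisfies the same hypotheses. Let $W\subset\mathbb R^d$ be an open set contained in $\partial D$ and in $\partial D'$. If for all $k<n$, all $q\ge0$ and all $s,t$ the coefficients of $x^k\log^q x$ in $\bar g_{st}$ and in $\bar g'_{st}$ agree on $W$, then for all $k<n$ and $q\ge0$ the coefficients of $x^k\log^q x$ in corresponding components of $\nabla^pR$ and of $\nabla'^pR'$ agree on $W$. -/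

import Mathlib

open Set Filter Topology Asymptotics
open scoped Manifold ContDiff Bundle

noncomputable section

namespace AsympHyp

/-! ### Half-space coordinates

Coordinates on a manifold of dimension `m = d + 1` are `z = (z 0, z 1, …, z d)`; the coordinate
`z 0` is the boundary defining function `x` and `(z 1, …, z d)` are the coordinates `y` along the
boundary. -/

/-- The coordinate space `ℝ^(d+1)`. -/
abbrev Coord (d : ℕ) : Type := EuclideanSpace ℝ (Fin (d + 1))

/-- The coordinate space `ℝ^d` of the boundary. -/
abbrev BdCoord (d : ℕ) : Type := EuclideanSpace ℝ (Fin d)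

/-- The boundary coordinates `y` of `z = (x, y)`. -/
def bdPart {d : ℕ} (z : Coord d) : BdCoord d := WithLp.toLp 2 (fun i => z i.succ)

/-- The point `(0, y)`. -/
def bdPoint {d : ℕ} (y : BdCoord d) : Coord d :=
  WithLp.toLp 2 (Fin.cons (0 : ℝ) (fun i => y i))

/-- The open half-space `{x > 0}`. -/
def posHalf (d : ℕ) : Set (Coord d) := {z | 0 < z 0}

/-- The boundary slice `{y | (0, y) ∈ D}` of a set `D`. -/
def bdSlice {d : ℕ} (D : Set (Coord d)) : Set (BdCoord d) := {y | bdPoint y ∈ D}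

/-- The partial derivative `∂_s f`. -/
def pd {d : ℕ} (s : Fin (d + 1)) (f : Coord d → ℝ) (z : Coord d) : ℝ :=
  fderiv ℝ f z (EuclideanSpace.single s (1 : ℝ))

/-! ### Polyhomogeneous functions -/

/-- The vector fields tangent to the boundary: `x ∂_x` for `s = 0` and `∂_{y_s}` for `s ≠ 0`. -/
def bDeriv {d : ℕ} (s : Fin (d + 1)) (f : Coord d → ℝ) (z : Coord d) : ℝ :=
  if s = 0 then z 0 * pd 0 f z else pd s f z

/-- Iterated derivatives along the vector fields `x ∂_x`, `∂_{y_i}`. -/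
def iterBDeriv {d : ℕ} (L : List (Fin (d + 1))) (f : Coord d → ℝ) : Coord d → ℝ :=
  L.foldr bDeriv f

/-- The partial sum `∑_{k₀ ≤ k ≤ N} ∑_{p ≤ P k} a_{k,p}(y) x^k (log x)^p`. -/
def phgSum {d : ℕ} (k₀ : ℤ) (P : ℤ → ℕ) (a : ℤ → ℕ → BdCoord d → ℝ) (N : ℤ) (z : Coord d) : ℝ :=
  ∑ k ∈ Finset.Icc k₀ N, ∑ p ∈ Finset.range (P k + 1),
    a k p (bdPart z) * z 0 ^ k * Real.log (z 0) ^ p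

/-- `f`, a function on the part `x > 0` of a relatively open subset `D` of the closed half-space
`{x ≥ 0}`, is smooth there and has at `x = 0` the polyhomogeneous expansion
`f ∼ ∑_{k ≥ k₀} ∑_{p ≤ P k} a_{k,p}(y) x^k (log x)^p` with smooth coefficients: after subtraction
of the terms with `k ≤ N` the remainder, with all its derivatives along `x ∂_x` and `∂_{y_i}`, is
`O(x^N)`, locally uniformly up to the boundary. (As this is required for every `N`, the remainder is
then in fact `O(x^(N+1) |log x|^(P (N+1)))`.) The coefficients that do not occur in the expansion
are set to zero. -/
def HasPhgExpansion {d : ℕ} (D : Set (Coord d)) (f : Coord d → ℝ)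
    (a : ℤ → ℕ → BdCoord d → ℝ) : Prop :=
  ContDiffOn ℝ ∞ f (D ∩ posHalf d) ∧
  (∀ k p, ContDiffOn ℝ ∞ (a k p) (bdSlice D)) ∧
  ∃ (k₀ : ℤ) (P : ℤ → ℕ),
    (∀ k p, (k < k₀ ∨ P k < p) → ∀ y ∈ bdSlice D, a k p y = 0) ∧
    ∀ (N : ℤ) (L : List (Fin (d + 1))), ∀ y ∈ bdSlice D,
      iterBDeriv L (fun z => f z - phgSum k₀ P a N z)
        =O[𝓝[posHalf d] (bdPoint y)] fun z => z 0 ^ N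

/-- `f` is polyhomogeneous. -/
def IsPhg {d : ℕ} (D : Set (Coord d)) (f : Coord d → ℝ) : Prop :=
  ∃ a, HasPhgExpansion D f a

/-- `f`, a function on the part `x > 0` of `D`, extends continuously to `D`. -/
def ExtendsContinuously {d : ℕ} (D : Set (Coord d)) (f : Coord d → ℝ) : Prop :=
  ∃ F : Coord d → ℝ, ContinuousOn F D ∧ EqOn F f (D ∩ posHalf d)

/-! ### Curvature in coordinates -/

/-- The matrix of components of a metric in coordinates, as a function of the coordinates. -/
abbrev CoordMetric (d : ℕ) : Type := Coord d → Matrix (Fin (d + 1)) (Fin (d + 1)) ℝ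

/-- A covariant tensor with `q` indices in coordinates. -/
abbrev CoordTensor (d q : ℕ) : Type := (Fin q → Fin (d + 1)) → Coord d → ℝ

/-- Christoffel symbols `Γ^k_{ij} = ½ g^{kl} (∂_i g_{jl} + ∂_j g_{il} - ∂_l g_{ij})`. -/
def christoffel {d : ℕ} (G : CoordMetric d) (k i j : Fin (d + 1)) (z : Coord d) : ℝ :=
  1 / 2 * ∑ l, (G z)⁻¹ k l *
    (pd i (fun w => G w j l) z + pd j (fun w => G w i l) z - pd l (fun w => G w i j) z)

/-- `R^s_{tuv}`, where `R(∂_u, ∂_v) ∂_t = R^s_{tuv} ∂_s` and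
`R(X, Y) = [∇_X, ∇_Y] - ∇_{[X, Y]}`. -/
def riemannUp {d : ℕ} (G : CoordMetric d) (s t u v : Fin (d + 1)) (z : Coord d) : ℝ :=
  pd u (christoffel G s v t) z - pd v (christoffel G s u t) z +
    ∑ w, (christoffel G s u w z * christoffel G w v t z
      - christoffel G s v w z * christoffel G w u t z)

/-- `R_{stuv} = g(R(∂_u, ∂_v) ∂_t, ∂_s)`. -/
def riemann {d : ℕ} (G : CoordMetric d) : CoordTensor d 4 :=
  fun I z => ∑ w, G z (I 0) w * riemannUp G w (I 1) (I 2) (I 3) z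

/-- The covariant derivative `T_{I;α} = ∂_α T_I - ∑_j Γ^β_{α I_j} T_{I with β in place j}`. -/
def covDeriv {d q : ℕ} (G : CoordMetric d) (T : CoordTensor d q) : CoordTensor d (q + 1) :=
  fun I z => pd (I (Fin.last q)) (T (Fin.init I)) z -
    ∑ j : Fin q, ∑ β, christoffel G β (I (Fin.last q)) (Fin.init I j) z *
      T (Function.update (Fin.init I) j β) z

/-- `∇^p R`, with components `R_{stuv;α₁…α_p}` with respect to the coordinate vector fields. -/
def curvatureJet {d : ℕ} (G : CoordMetric d) : (p : ℕ) → CoordTensor d (4 + p)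
  | 0 => riemann G
  | p + 1 => covDeriv G (curvatureJet G p)

/-- The components of the tensor `T` with respect to the frame `X_s = x ∂_s` and its dual coframe
`dz_s / x`, where the indices in the positions `S` have been raised by the metric `G`. (For
`S = ∅` this is `T(X_{I_0}, X_{I_1}, …) = x^q T_I`.) -/
def frameComponent {d q : ℕ} (G : CoordMetric d) (T : CoordTensor d q) (S : Finset (Fin q)) :
    CoordTensor d q :=
  fun I z => z 0 ^ ((q : ℤ) - 2 * (S.card : ℤ)) *
    ∑ J : Fin q → Fin (d + 1),
      (∏ j, if j ∈ S then (G z)⁻¹ (I j) (J j) else if I j = J j then 1 else 0) * T J z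

/-! ### Asymptotically hyperbolic metrics -/

section Manifold

variable (d : ℕ) (M : Type*) [TopologicalSpace M] [ChartedSpace (EuclideanHalfSpace (d + 1)) M]
  [IsManifold (𝓡∂ (d + 1)) ∞ M]

/-- A conformally compact metric on the interior of a manifold with boundary `M` of dimension
`d + 1`, together with a boundary defining function `x` and the metric `x² g` extended to `M`.
As the metric `x² g` is not smooth at the boundary in general, neither need the boundary defining
functions adapted to it be; they are only required to be `C¹` there. -/
structure ConformallyCompactMetric where
  /-- The metric; only its values in the interior of `M` are meaningful. -/
  g : ∀ p : M, TangentSpace (𝓡∂ (d + 1)) p →L[ℝ] TangentSpace (𝓡∂ (d + 1)) p →L[ℝ] ℝ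
  g_symm : ∀ p ∈ (𝓡∂ (d + 1)).interior M, ∀ v w, g p v w = g p w v
  g_pos : ∀ p ∈ (𝓡∂ (d + 1)).interior M, ∀ v, v ≠ 0 → 0 < g p v v
  g_smooth : ContMDiffOn (𝓡∂ (d + 1))
    ((𝓡∂ (d + 1)).prod 𝓘(ℝ, Coord d →L[ℝ] Coord d →L[ℝ] ℝ)) ∞
    (fun p => Bundle.TotalSpace.mk' (Coord d →L[ℝ] Coord d →L[ℝ] ℝ)
      (E := fun p : M => TangentSpace (𝓡∂ (d + 1)) p →L[ℝ] TangentSpace (𝓡∂ (d + 1)) p →L[ℝ] ℝ)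
      p (g p))
    ((𝓡∂ (d + 1)).interior M)
  /-- The boundary defining function. -/
  x : M → ℝ
  x_C1 : ContMDiff (𝓡∂ (d + 1)) 𝓘(ℝ, ℝ) 1 x
  x_smooth : ContMDiffOn (𝓡∂ (d + 1)) 𝓘(ℝ, ℝ) ∞ x ((𝓡∂ (d + 1)).interior M)
  x_pos : ∀ p ∈ (𝓡∂ (d + 1)).interior M, 0 < x p
  x_zero : ∀ p ∈ (𝓡∂ (d + 1)).boundary M, x p = 0
  dx_ne_zero : ∀ p ∈ (𝓡∂ (d + 1)).boundary M, mfderiv (𝓡∂ (d + 1)) 𝓘(ℝ, ℝ) x p ≠ 0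
  /-- The continuous extension of `x² g` to a metric on `M`. -/
  gbar : Bundle.ContinuousRiemannianMetric (Coord d)
    (fun p : M => TangentSpace (𝓡∂ (d + 1)) p)
  gbar_eq : ∀ p ∈ (𝓡∂ (d + 1)).interior M, ∀ v w, gbar.inner p v w = x p ^ 2 * g p v w

variable {d M}

namespace ConformallyCompactMetric

/-- `|dx| = 1` at `p` with respect to `x² g`: the gradient of `x` is a unit vector. -/
def UnitDxAt (X : ConformallyCompactMetric d M) (p : M) : Prop :=
  ∃ v : TangentSpace (𝓡∂ (d + 1)) p,
    (∀ w : TangentSpace (𝓡∂ (d + 1)) p,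
      X.gbar.inner p v w = (mfderiv (𝓡∂ (d + 1)) 𝓘(ℝ, ℝ) X.x p w : ℝ)) ∧
    X.gbar.inner p v v = 1

/-- `g` is asymptotically hyperbolic: `|dx| = 1` on the boundary. -/
def IsAsymptoticallyHyperbolic (X : ConformallyCompactMetric d M) : Prop :=
  ∀ p ∈ (𝓡∂ (d + 1)).boundary M, X.UnitDxAt p

/-- `x` is special: `|dx| = 1` on a neighbourhood of the boundary. -/
def IsSpecial (X : ConformallyCompactMetric d M) : Prop :=
  ∃ U : Set M, IsOpen U ∧ (𝓡∂ (d + 1)).boundary M ⊆ U ∧ ∀ p ∈ U, X.UnitDxAt p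

end ConformallyCompactMetric

/-- The domain in `ℝ^(d+1)` of the coordinates given by the chart `φ`, a relatively open subset of
the closed half-space. -/
def chartDomain (φ : OpenPartialHomeomorph M (EuclideanHalfSpace (d + 1))) : Set (Coord d) :=
  (φ.extend (𝓡∂ (d + 1))).target

/-- The coordinate vector field `∂_s` of the chart `φ`, at the point with coordinates `z`. -/
def coordVector (φ : OpenPartialHomeomorph M (EuclideanHalfSpace (d + 1))) (z : Coord d)
    (s : Fin (d + 1)) :
    TangentSpace (𝓡∂ (d + 1)) ((φ.extend (𝓡∂ (d + 1))).symm z) :=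
  mfderivWithin 𝓘(ℝ, Coord d) (𝓡∂ (d + 1)) (φ.extend (𝓡∂ (d + 1))).symm (range (𝓡∂ (d + 1))) z
    (EuclideanSpace.single s (1 : ℝ) : Coord d)

/-- The components `B(∂_s, ∂_t)` of a field `B` of bilinear forms in the chart `φ`. -/
def coordMetric
    (B : ∀ p : M, TangentSpace (𝓡∂ (d + 1)) p →L[ℝ] TangentSpace (𝓡∂ (d + 1)) p →L[ℝ] ℝ)
    (φ : OpenPartialHomeomorph M (EuclideanHalfSpace (d + 1))) : CoordMetric d :=
  fun z => Matrix.of fun s t =>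
    B ((φ.extend (𝓡∂ (d + 1))).symm z) (coordVector φ z s) (coordVector φ z t)

namespace ConformallyCompactMetric

/-- The components of `g` in the chart `φ`. -/
def gComp (X : ConformallyCompactMetric d M)
    (φ : OpenPartialHomeomorph M (EuclideanHalfSpace (d + 1))) : CoordMetric d :=
  coordMetric X.g φ

/-- The components of `x² g` in the chart `φ`. -/
def gbarComp (X : ConformallyCompactMetric d M)
    (φ : OpenPartialHomeomorph M (EuclideanHalfSpace (d + 1))) : CoordMetric d :=
  coordMetric X.gbar.inner φ

/-- `φ` gives coordinates `(x, y_1, …, y_d)` for `x² g` in which the `y_i` are coordinates on the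
boundary extended along the geodesics normal to the boundary: the first coordinate is `x` and
`(x² g)(∂_s, ∂_x) = δ_{sx}` throughout the chart. The coordinates are smooth in the interior, and
`C¹` up to the boundary. -/
structure IsAdaptedChart (X : ConformallyCompactMetric d M)
    (φ : OpenPartialHomeomorph M (EuclideanHalfSpace (d + 1))) : Prop where
  C1 : ContMDiffOn (𝓡∂ (d + 1)) (𝓡∂ (d + 1)) 1 φ φ.source
  C1_symm : ContMDiffOn (𝓡∂ (d + 1)) (𝓡∂ (d + 1)) 1 φ.symm φ.target
  smooth : ContMDiffOn (𝓡∂ (d + 1)) (𝓡∂ (d + 1)) ∞ φ (φ.source ∩ (𝓡∂ (d + 1)).interior M)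
  smooth_symm : ContMDiffOn (𝓡∂ (d + 1)) (𝓡∂ (d + 1)) ∞ φ.symm
    (φ.target ∩ φ.symm ⁻¹' (𝓡∂ (d + 1)).interior M)
  coord_zero : ∀ p ∈ φ.source, (φ p).val 0 = X.x p
  orthogonal : ∀ z ∈ chartDomain φ, ∀ s, X.gbarComp φ z s 0 = if s = 0 then 1 else 0

/-- The components of `∇^p R`, the `p`-th covariant derivative of the curvature tensor of `g`, with
respect to the frame `X_s = x ∂_s` in the chart `φ`, with the indices in the positions `S` raised
by `g` and all other indices lowered. -/
def curvatureComp (X : ConformallyCompactMetric d M)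
    (φ : OpenPartialHomeomorph M (EuclideanHalfSpace (d + 1))) (p : ℕ) (S : Finset (Fin (4 + p))) :
    CoordTensor d (4 + p) :=
  frameComponent (X.gComp φ) (curvatureJet (X.gComp φ) p) S

end ConformallyCompactMetric

end Manifold

end AsympHyp

end

noncomputable section

namespace AsympHyp

/-! ### Conormal functions -/

section Conormal

variable {d : ℕ}

/-! Write `g = x⁻² ḡ`. Give every lower index a factor `x` and every upper index a factor `x⁻¹`.
Since `x^(q+1) ∂_s T = x∂_s(x^q T) - q δ_{s0} x^q T`, a coordinate derivative of a weighted quantity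
is obtained from `x∂_s` and ring operations. So `x² g`, `x⁻² g⁻¹`, `x Γ`, `x⁴ R` and `x^(4+p) ∇^p R`
have components that are universal polynomials in the `ḡ_st`, in `1 / det ḡ` and in their iterated
derivatives along `x∂_s`. Any class of functions closed under ring operations and `x∂_s` that
contains the `ḡ_st` and `1 / det ḡ` therefore contains all frame components.
`IsFrameRelation.curvature` proves this for binary relations instead of classes, so that one
argument serves both claims.

For (1) the class is that of bounded polyhomogeneous functions: those approximated to every order by
finite sums of `a(y) x^k log^p x` with `k ≥ 0` and no logarithm at `k = 0`, with conormal errors.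
Continuity of `ḡ` up to the boundary puts its entries in this class
(`HasPhgExpansion.isBoundedPhg`), and a geometric series gives `1 / det ḡ` (`IsBoundedPhg.inv`).
Conversely, members of the class have a full expansion (`IsBoundedPhg.isPhg`) and extend by their
leading coefficient (`IsBoundedPhg.extendsContinuously`).

For (2) two functions are related if both are conormal of order `0` and their difference is conormal
of order `n - 1/2`. This order separates the terms below `x^n` from the others, whatever their
logarithms. Uniqueness of expansions (`coeff_eq_zero_of_isBigO`) makes the relation equivalent, for
such functions with expansions, to equality of the coefficients below `x^n`. -/

/-- The filter of punctured half-neighbourhoods of the boundary point `(0, y)`. -/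
def bdFilter (y : BdCoord d) : Filter (Coord d) := 𝓝[posHalf d] (bdPoint y)

/-- `f` is smooth near `(0, y)` in `x > 0`, and it and its derivatives along `x ∂_x`, `∂_{y_i}` up
to order `m` are `O(x^r)`. -/
def ConormalUpTo (r : ℝ) (y : BdCoord d) : ℕ → (Coord d → ℝ) → Prop
  | 0, f => (∀ᶠ z in bdFilter y, ContDiffAt ℝ ∞ f z) ∧ f =O[bdFilter y] fun z => z 0 ^ r
  | m + 1, f => ConormalUpTo r y m f ∧ ∀ s, ConormalUpTo r y m (bDeriv s f)

/-- `f` is smooth near `(0, y)` in `x > 0` and conormal of order `r`. -/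
def Conormal (r : ℝ) (y : BdCoord d) (f : Coord d → ℝ) : Prop := ∀ m, ConormalUpTo r y m f

theorem isOpen_posHalf : IsOpen (posHalf d) :=
  isOpen_lt continuous_const (by fun_prop)

theorem eventually_posHalf (y : BdCoord d) : ∀ᶠ z in bdFilter y, 0 < z 0 :=
  eventually_mem_nhdsWithin

/-- The half-space `x > 0` is open, so an identity that holds along the filter holds near each of
its points and may be differentiated there. -/
theorem eventually_eventually_bdFilter {y : BdCoord d} {p : Coord d → Prop}
    (h : ∀ᶠ z in bdFilter y, p z) : ∀ᶠ z in bdFilter y, ∀ᶠ w in 𝓝 z, p w := by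
  have h' := eventually_eventually_nhdsWithin.2 h
  filter_upwards [h', eventually_posHalf y] with z hz hz0
  rwa [isOpen_posHalf.nhdsWithin_eq (show z ∈ posHalf d from hz0)] at hz

variable {y : BdCoord d} {f g : Coord d → ℝ} {r r' : ℝ} {m : ℕ}

theorem bDeriv_eq_of_eventuallyEq {z : Coord d} (h : f =ᶠ[𝓝 z] g) (s : Fin (d + 1)) :
    bDeriv s f z = bDeriv s g z := by
  simp only [bDeriv, pd, h.fderiv_eq]

theorem bDeriv_congr (h : f =ᶠ[bdFilter y] g) (s : Fin (d + 1)) :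
    bDeriv s f =ᶠ[bdFilter y] bDeriv s g := by
  filter_upwards [eventually_eventually_bdFilter h] with z hz
  exact bDeriv_eq_of_eventuallyEq hz s

theorem bDeriv_add {z : Coord d} (s : Fin (d + 1)) (hf : DifferentiableAt ℝ f z)
    (hg : DifferentiableAt ℝ g z) :
    bDeriv s (fun w => f w + g w) z = bDeriv s f z + bDeriv s g z := by
  simp only [bDeriv, pd, fderiv_fun_add hf hg, _root_.add_apply]
  split_ifs <;> ring

theorem bDeriv_mul {z : Coord d} (s : Fin (d + 1)) (hf : DifferentiableAt ℝ f z)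
    (hg : DifferentiableAt ℝ g z) :
    bDeriv s (fun w => f w * g w) z = bDeriv s f z * g z + f z * bDeriv s g z := by
  simp only [bDeriv, pd, fderiv_fun_mul hf hg, _root_.add_apply,
    _root_.smul_apply, smul_eq_mul]
  split_ifs <;> ring

theorem bDeriv_inv {z : Coord d} (s : Fin (d + 1)) (hf : DifferentiableAt ℝ f z) (h0 : f z ≠ 0) :
    bDeriv s (fun w => (f w)⁻¹) z = -1 * (bDeriv s f z * ((f z)⁻¹ * (f z)⁻¹)) := by
  have h := (hasDerivAt_inv h0).comp_hasFDerivAt z hf.hasFDerivAt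
  have h2 : fderiv ℝ (fun w => (f w)⁻¹) z = -(f z ^ 2)⁻¹ • fderiv ℝ f z := h.fderiv
  simp only [bDeriv, pd, h2, _root_.smul_apply, smul_eq_mul]
  split_ifs <;> field_simp

theorem contDiffAt_pd {z : Coord d} (hf : ContDiffAt ℝ ∞ f z) (s : Fin (d + 1)) :
    ContDiffAt ℝ ∞ (pd s f) z :=
  (hf.fderiv_right (m := ∞) (by simp)).clm_apply contDiffAt_const

theorem contDiffAt_coord {z : Coord d} (s : Fin (d + 1)) :
    ContDiffAt ℝ ∞ (fun w : Coord d => w s) z := by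
  fun_prop

theorem contDiffAt_bDeriv {z : Coord d} (hf : ContDiffAt ℝ ∞ f z) (s : Fin (d + 1)) :
    ContDiffAt ℝ ∞ (AsympHyp.bDeriv s f) z := by
  by_cases hs : s = 0
  · have : AsympHyp.bDeriv s f = fun z => z 0 * AsympHyp.pd 0 f z := by
      ext w; simp [AsympHyp.bDeriv, hs]
    rw [this]
    exact (contDiffAt_coord 0).mul (contDiffAt_pd hf 0)
  · have : AsympHyp.bDeriv s f = AsympHyp.pd s f := by
      ext w; simp [AsympHyp.bDeriv, hs]
    rw [this]
    exact contDiffAt_pd hf s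

theorem ConormalUpTo.smooth : ∀ {m : ℕ} {f : Coord d → ℝ}, ConormalUpTo r y m f →
    ∀ᶠ z in bdFilter y, ContDiffAt ℝ ∞ f z
  | 0, _, h => h.1
  | _ + 1, _, h => h.1.smooth

theorem ConormalUpTo.isBigO : ∀ {m : ℕ} {f : Coord d → ℝ}, ConormalUpTo r y m f →
    f =O[bdFilter y] fun z => z 0 ^ r
  | 0, _, h => h.2
  | _ + 1, _, h => h.1.isBigO

theorem ConormalUpTo.congr (hf : ConormalUpTo r y m f) (h : f =ᶠ[bdFilter y] g) :
    ConormalUpTo r y m g := by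
  induction m generalizing f g with
  | zero =>
    refine ⟨?_, hf.2.congr' h .rfl⟩
    filter_upwards [hf.1, eventually_eventually_bdFilter h] with z h1 h2
    exact h1.congr_of_eventuallyEq (EventuallyEq.symm h2)
  | succ m ih => exact ⟨ih hf.1 h, fun s => ih (hf.2 s) (bDeriv_congr h s)⟩

theorem differentiableAt_of_smooth {z : Coord d} (hf : ContDiffAt ℝ ∞ f z) :
    DifferentiableAt ℝ f z := hf.differentiableAt (by simp)

theorem ConormalUpTo.add (hf : ConormalUpTo r y m f) (hg : ConormalUpTo r y m g) :
    ConormalUpTo r y m (fun z => f z + g z) := by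
  induction m generalizing f g with
  | zero =>
    refine ⟨?_, hf.2.add hg.2⟩
    filter_upwards [hf.1, hg.1] with z h1 h2 using h1.add h2
  | succ m ih =>
    refine ⟨ih hf.1 hg.1, fun s => (ih (hf.2 s) (hg.2 s)).congr ?_⟩
    filter_upwards [hf.smooth, hg.smooth] with z h1 h2
    exact (bDeriv_add s (differentiableAt_of_smooth h1) (differentiableAt_of_smooth h2)).symm

theorem ConormalUpTo.mul (hf : ConormalUpTo r y m f) (hg : ConormalUpTo r' y m g) :
    ConormalUpTo (r + r') y m (fun z => f z * g z) := by
  induction m generalizing f g with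
  | zero =>
    refine ⟨?_, (hf.2.mul hg.2).congr' .rfl ?_⟩
    · filter_upwards [hf.1, hg.1] with z h1 h2 using h1.mul h2
    · filter_upwards [eventually_posHalf y] with z hz
      rw [Real.rpow_add hz]
  | succ m ih =>
    refine ⟨ih hf.1 hg.1, fun s => ((ih (hf.2 s) hg.1).add (ih hf.1 (hg.2 s))).congr ?_⟩
    filter_upwards [hf.smooth, hg.smooth] with z h1 h2
    exact (bDeriv_mul s (differentiableAt_of_smooth h1) (differentiableAt_of_smooth h2)).symm

theorem bdFilter_le (y : BdCoord d) : bdFilter y ≤ 𝓝 (bdPoint y) := nhdsWithin_le_nhds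

theorem tendsto_coord_zero (y : BdCoord d) :
    Tendsto (fun z : Coord d => z 0) (bdFilter y) (𝓝[>] 0) := by
  refine tendsto_nhdsWithin_iff.2 ⟨?_, eventually_posHalf y⟩
  have : Continuous fun z : Coord d => z 0 := by fun_prop
  have h := (this.tendsto (bdPoint y)).mono_left (bdFilter_le y)
  simpa [bdPoint] using h

theorem isBigO_rpow_of_le (h : r' ≤ r) :
    (fun x : ℝ => x ^ r) =O[𝓝[>] 0] fun x => x ^ r' := by
  refine IsBigO.of_bound 1 ?_
  have h1 : ∀ᶠ x : ℝ in 𝓝[>] 0, x < 1 := nhdsWithin_le_nhds (Iio_mem_nhds one_pos)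
  filter_upwards [h1, eventually_mem_nhdsWithin] with x hx hx0
  have hx0 : 0 < x := hx0
  rw [Real.norm_of_nonneg (by positivity), Real.norm_of_nonneg (by positivity), one_mul]
  exact Real.rpow_le_rpow_of_exponent_ge hx0 hx.le h

theorem ConormalUpTo.mono (hf : ConormalUpTo r y m f) (h : r' ≤ r) : ConormalUpTo r' y m f := by
  induction m generalizing f with
  | zero => exact ⟨hf.1, hf.2.trans ((isBigO_rpow_of_le h).comp_tendsto (tendsto_coord_zero y))⟩
  | succ m ih => exact ⟨ih hf.1, fun s => ih (hf.2 s)⟩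

theorem Conormal.congr (hf : Conormal r y f) (h : f =ᶠ[bdFilter y] g) : Conormal r y g :=
  fun m => (hf m).congr h

theorem Conormal.smooth (hf : Conormal r y f) : ∀ᶠ z in bdFilter y, ContDiffAt ℝ ∞ f z :=
  (hf 0).smooth

theorem Conormal.isBigO (hf : Conormal r y f) : f =O[bdFilter y] fun z => z 0 ^ r :=
  (hf 0).isBigO

theorem Conormal.mono (hf : Conormal r y f) (h : r' ≤ r) : Conormal r' y f :=
  fun m => (hf m).mono h

theorem Conormal.add (hf : Conormal r y f) (hg : Conormal r y g) :
    Conormal r y (fun z => f z + g z) := fun m => (hf m).add (hg m)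

theorem Conormal.mul (hf : Conormal r y f) (hg : Conormal r' y g) :
    Conormal (r + r') y (fun z => f z * g z) := fun m => (hf m).mul (hg m)

theorem Conormal.bDeriv (hf : Conormal r y f) (s : Fin (d + 1)) :
    Conormal r y (AsympHyp.bDeriv s f) := fun m => (hf (m + 1)).2 s

theorem conormalUpTo_const (hr : r ≤ 0) (c : ℝ) : ConormalUpTo r y m (fun _ => c) := by
  induction m generalizing c with
  | zero =>
    refine ⟨Eventually.of_forall fun _ => contDiffAt_const, ?_⟩
    have h := ((isBigO_const_const c (one_ne_zero (α := ℝ)) (𝓝[>] (0 : ℝ))).trans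
      ((isBigO_rpow_of_le hr).congr_left (fun x => Real.rpow_zero x)))
    exact h.comp_tendsto (tendsto_coord_zero y)
  | succ m ih =>
    refine ⟨ih c, fun s => ?_⟩
    have : bDeriv s (fun _ : Coord d => c) = fun _ => 0 := by
      ext z; simp [bDeriv, pd]
    rw [this]
    exact ih 0

theorem conormal_const (hr : r ≤ 0) (c : ℝ) : Conormal r y (fun _ => c) :=
  fun _ => conormalUpTo_const hr c

theorem Conormal.const_mul (hf : Conormal r y f) (c : ℝ) : Conormal r y (fun z => c * f z) := by
  simpa using (conormal_const le_rfl c).mul hf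

theorem conormal_zero : Conormal r y (fun _ => 0) := fun m => by
  induction m with
  | zero => exact ⟨Eventually.of_forall fun _ => contDiffAt_const, isBigO_zero _ _⟩
  | succ m ih =>
    refine ⟨ih, fun s => ?_⟩
    have : bDeriv s (fun _ : Coord d => (0 : ℝ)) = fun _ => 0 := by
      ext z; simp [bDeriv, pd]
    rwa [this]

theorem Conormal.neg (hf : Conormal r y f) : Conormal r y (fun z => -f z) := by
  simpa using hf.const_mul (-1)

theorem Conormal.sub (hf : Conormal r y f) (hg : Conormal r y g) :
    Conormal r y (fun z => f z - g z) := by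
  simpa [sub_eq_add_neg] using hf.add hg.neg

theorem Conormal.sum {ι : Type*} (s : Finset ι) {F : ι → Coord d → ℝ}
    (h : ∀ i ∈ s, Conormal r y (F i)) : Conormal r y (fun z => ∑ i ∈ s, F i z) := by
  classical
  induction s using Finset.induction_on with
  | empty => simpa using conormal_zero
  | insert i s hi ih =>
    simp only [Finset.sum_insert hi]
    exact (h i (by simp)).add (ih fun j hj => h j (by simp [hj]))

theorem Conormal.pow (hf : Conormal r y f) (k : ℕ) : Conormal (k * r) y (fun z => f z ^ k) := by
  induction k with
  | zero => simpa using conormal_const le_rfl 1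
  | succ k ih =>
    have := ih.mul hf
    simp only [pow_succ]
    convert this using 1
    push_cast; ring

/-- The inverse of a conormal function of order `0` that is bounded away from zero. -/
theorem Conormal.inv (hf : Conormal 0 y f) (h0 : ∀ᶠ z in bdFilter y, f z ≠ 0)
    (hb : (fun z => (f z)⁻¹) =O[bdFilter y] fun _ => (1 : ℝ)) :
    Conormal 0 y (fun z => (f z)⁻¹) := fun m => by
  induction m with
  | zero =>
    refine ⟨?_, by simpa using hb⟩
    filter_upwards [hf.smooth, h0] with z h1 h2 using h1.inv h2
  | succ m ih =>
    refine ⟨ih, fun s => ?_⟩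
    -- The derivative of `1/f` is `-f' · f⁻¹ · f⁻¹`, which involves `f⁻¹` only to the order already
    -- treated.
    have h1 := (conormalUpTo_const (y := y) (m := m) le_rfl (-1)).mul
      ((hf.bDeriv s m).mul (ih.mul ih))
    simp only [add_zero] at h1
    refine h1.congr ?_
    filter_upwards [hf.smooth, h0] with z h1 h2
    exact (bDeriv_inv s (differentiableAt_of_smooth h1) h2).symm

theorem iterBDeriv_append (L L' : List (Fin (d + 1))) (f : Coord d → ℝ) :
    iterBDeriv (L ++ L') f = iterBDeriv L (iterBDeriv L' f) := by
  simp [iterBDeriv, List.foldr_append]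

theorem Conormal.iterBDeriv (hf : Conormal r y f) (L : List (Fin (d + 1))) :
    Conormal r y (AsympHyp.iterBDeriv L f) := by
  induction L with
  | nil => exact hf
  | cons s L ih => exact ih.bDeriv s

/-- The iterated derivatives of `bDeriv s f` are those of `f` along lists ending in `s`, hence the
induction over varying `f`. -/
theorem conormal_of_iterBDeriv (hs : ∀ᶠ z in bdFilter y, ContDiffAt ℝ ∞ f z)
    (h : ∀ L, iterBDeriv L f =O[bdFilter y] fun z => z 0 ^ r) : Conormal r y f := fun m => by
  induction m generalizing f with
  | zero => exact ⟨hs, h []⟩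
  | succ m ih =>
    refine ⟨ih hs h, fun s => ih ?_ fun L => ?_⟩
    · filter_upwards [hs] with z hz using contDiffAt_bDeriv hz s
    · simpa [iterBDeriv_append, iterBDeriv] using h (L ++ [s])

end Conormal

/-! ### Elementary polyhomogeneous functions -/

section Elementary

variable {d : ℕ} {y : BdCoord d} {f g : Coord d → ℝ} {r r' : ℝ} {B : Set (BdCoord d)}

/-! ### Functions of `x` alone and functions of `y` alone -/

theorem hasFDerivAt_coord (s : Fin (d + 1)) (z : Coord d) :
    HasFDerivAt (fun w : Coord d => w s) (EuclideanSpace.proj s : Coord d →L[ℝ] ℝ) z :=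
  (EuclideanSpace.proj s : Coord d →L[ℝ] ℝ).hasFDerivAt

theorem bDeriv_comp_coord_zero {h : ℝ → ℝ} {h' : ℝ} {z : Coord d} (s : Fin (d + 1))
    (hh : HasDerivAt h h' (z 0)) :
    bDeriv s (fun w => h (w 0)) z = if s = 0 then z 0 * h' else 0 := by
  have h1 : HasFDerivAt (fun w : Coord d => h (w 0)) _ z :=
    hh.comp_hasFDerivAt z (hasFDerivAt_coord 0 z)
  simp only [bDeriv, pd, h1.fderiv]
  split_ifs with hs
  · simp
  · simp [Ne.symm hs]

/-- The projection to the boundary coordinates. -/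
def bdPartL (d : ℕ) : Coord d →L[ℝ] BdCoord d :=
  LinearMap.toContinuousLinearMap
    { toFun := bdPart
      map_add' := fun _ _ => rfl
      map_smul' := fun _ _ => rfl }

theorem bdPartL_apply (z : Coord d) : bdPartL d z = bdPart z := rfl

theorem contDiff_bdPart : ContDiff ℝ ∞ (bdPart : Coord d → BdCoord d) := (bdPartL d).contDiff

theorem bdPart_bdPoint (y : BdCoord d) : bdPart (bdPoint y) = y := by
  ext i; simp [bdPart, bdPoint]

theorem bdPart_single_zero : bdPart (EuclideanSpace.single (0 : Fin (d + 1)) (1 : ℝ)) = 0 := by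
  ext i; simp [bdPart]

theorem tendsto_bdPart (y : BdCoord d) : Tendsto bdPart (bdFilter y) (𝓝 y) := by
  have h := (contDiff_bdPart (d := d)).continuous.tendsto (bdPoint y)
  rw [bdPart_bdPoint] at h
  exact h.mono_left (bdFilter_le y)

theorem eventually_bdPart_mem (hB : IsOpen B) (hy : y ∈ B) : ∀ᶠ z in bdFilter y, bdPart z ∈ B :=
  tendsto_bdPart y (hB.mem_nhds hy)

/-- The point `(x, y)`. -/
def linePoint (y : BdCoord d) (x : ℝ) : Coord d := WithLp.toLp 2 (Fin.cons x fun i => y i)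

theorem linePoint_zero (y : BdCoord d) (x : ℝ) : linePoint y x 0 = x := rfl

theorem bdPart_linePoint (y : BdCoord d) (x : ℝ) : bdPart (linePoint y x) = y := by
  ext i; simp [bdPart, linePoint]

/-- Restriction to the normal ray over `y` reduces questions about coefficients at `y` to one
variable. -/
theorem tendsto_linePoint (y : BdCoord d) : Tendsto (linePoint y) (𝓝[>] 0) (bdFilter y) := by
  refine tendsto_nhdsWithin_iff.2 ⟨?_, eventually_mem_nhdsWithin⟩
  have h : Continuous (linePoint y) := by
    refine (PiLp.continuous_toLp 2 _).comp (continuous_pi fun i => ?_)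
    refine Fin.cases ?_ (fun i => ?_) i
    · simpa using continuous_id'
    · simpa using continuous_const
  exact (h.tendsto 0).mono_left nhdsWithin_le_nhds

instance (y : BdCoord d) : (bdFilter y).NeBot := (tendsto_linePoint y).neBot

/-- The partial derivative of a function on the boundary. -/
def bdDeriv (s : Fin (d + 1)) (a : BdCoord d → ℝ) (y : BdCoord d) : ℝ :=
  fderiv ℝ a y (bdPart (EuclideanSpace.single s (1 : ℝ)))

theorem bdDeriv_zero (a : BdCoord d → ℝ) : bdDeriv 0 a = 0 := by
  ext y; simp [bdDeriv, bdPart_single_zero]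

theorem ContDiffOn.bdDeriv {a : BdCoord d → ℝ} (hB : IsOpen B) (ha : ContDiffOn ℝ ∞ a B)
    (s : Fin (d + 1)) : ContDiffOn ℝ ∞ (AsympHyp.bdDeriv s a) B := fun y hy =>
  ((((ha.contDiffAt (hB.mem_nhds hy)).fderiv_right (m := ∞) (by simp)).clm_apply
    contDiffAt_const)).contDiffWithinAt

theorem bDeriv_comp_bdPart {a : BdCoord d → ℝ} {z : Coord d} (s : Fin (d + 1))
    (ha : DifferentiableAt ℝ a (bdPart z)) :
    bDeriv s (fun w => a (bdPart w)) z = bdDeriv s a (bdPart z) := by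
  have h1 : HasFDerivAt (fun w : Coord d => a (bdPart w)) _ z :=
    HasFDerivAt.comp z (g := a) (f := bdPartL d) ha.hasFDerivAt (bdPartL d).hasFDerivAt
  have h2 : ∀ t, pd t (fun w => a (bdPart w)) z = bdDeriv t a (bdPart z) := fun t => by
    simp [pd, h1.fderiv, bdDeriv, bdPartL_apply]
  simp only [bDeriv, h2]
  split_ifs with hs
  · simp [hs, bdDeriv_zero]
  · rfl

/-- Derivatives of `a(y)` along the tangent fields are again smooth functions of `y` alone, and
these are locally bounded. -/
theorem conormal_comp_bdPart {a : BdCoord d → ℝ} (hB : IsOpen B) (ha : ContDiffOn ℝ ∞ a B)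
    (hy : y ∈ B) : Conormal 0 y (fun z => a (bdPart z)) := fun m => by
  have hsm : ∀ a : BdCoord d → ℝ, ContDiffOn ℝ ∞ a B →
      ∀ᶠ z in bdFilter y, ContDiffAt ℝ ∞ a (bdPart z) := fun a ha => by
    filter_upwards [eventually_bdPart_mem hB hy] with z hz
    exact ha.contDiffAt (hB.mem_nhds hz)
  induction m generalizing a with
  | zero =>
    refine ⟨?_, ?_⟩
    · filter_upwards [hsm a ha] with z hz
      exact ContDiffAt.comp z hz contDiff_bdPart.contDiffAt
    · have h : Tendsto (fun z : Coord d => a (bdPart z)) (bdFilter y) (𝓝 (a y)) :=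
        ((ha.contDiffAt (hB.mem_nhds hy)).continuousAt.tendsto).comp (tendsto_bdPart y)
      simpa using h.isBigO_one ℝ
  | succ m ih =>
    refine ⟨ih ha, fun s => (ih (ContDiffOn.bdDeriv hB ha s)).congr ?_⟩
    filter_upwards [hsm a ha] with z hz
    exact (bDeriv_comp_bdPart s (hz.differentiableAt (by simp))).symm

theorem conormal_zpow (k : ℤ) : Conormal (k : ℝ) y (fun z => z 0 ^ k) := fun m => by
  -- Multiples are included because `x∂_x x^k = k x^k`.
  suffices h : ∀ c : ℝ, ConormalUpTo (k : ℝ) y m (fun z => c * z 0 ^ k) by simpa using h 1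
  induction m with
  | zero =>
    refine fun c => ⟨?_, IsBigO.const_mul_left ?_ c⟩
    · filter_upwards [eventually_posHalf y] with z hz
      exact contDiffAt_const.mul
        (ContDiffAt.comp (g := fun x : ℝ => x ^ k) z (analyticAt_id.zpow hz.ne').contDiffAt
          (contDiffAt_coord 0))
    · simp [Real.rpow_intCast, isBigO_refl]
  | succ m ih =>
    refine fun c => ⟨ih c, fun s => (ih (if s = 0 then c * k else 0)).congr ?_⟩
    filter_upwards [eventually_posHalf y] with z hz
    have h := (hasDerivAt_zpow k (z 0) (Or.inl hz.ne')).const_mul c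
    rw [bDeriv_comp_coord_zero s h]
    split_ifs
    · rw [zpow_sub_one₀ hz.ne']; field_simp
    · simp

/-- Only the undifferentiated logarithm is unbounded: its derivatives along the tangent fields start
with the constants `1` and `0`. -/
theorem conormal_log (hr : r < 0) : Conormal r y (fun z => Real.log (z 0)) := by
  have h0 : ConormalUpTo r y 0 (fun z => Real.log (z 0)) := by
    refine ⟨?_, ?_⟩
    · filter_upwards [eventually_posHalf y] with z hz
      exact ContDiffAt.comp z (Real.contDiffAt_log.2 hz.ne') (contDiffAt_coord 0)
    · have h := (isLittleO_log_rpow_nhdsGT_zero (r := r) hr).isBigO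
      exact h.comp_tendsto (tendsto_coord_zero y)
  intro m
  induction m with
  | zero => exact h0
  | succ m ih =>
    refine ⟨ih, fun s => ?_⟩
    refine (conormalUpTo_const (m := m) hr.le (if s = 0 then 1 else 0)).congr ?_
    filter_upwards [eventually_posHalf y] with z hz
    rw [bDeriv_comp_coord_zero s (Real.hasDerivAt_log hz.ne')]
    split_ifs
    · field_simp
    · rfl

theorem conormal_log_pow (hr : r < 0) (p : ℕ) :
    Conormal r y (fun z => Real.log (z 0) ^ p) := by
  -- The divisor `p + 1` also covers `p = 0`; the resulting order `p r / (p + 1)` is at least `r`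
  -- because `r < 0`.
  have h := (conormal_log (y := y) (r := r / (p + 1))
    (div_neg_of_neg_of_pos hr (by positivity))).pow p
  refine h.mono ?_
  rw [mul_div_assoc', le_div_iff₀ (by positivity)]
  nlinarith

/-- The gap between `r` and `k` absorbs the logarithms; without them order `k` itself is reached. -/
theorem conormal_term {a : BdCoord d → ℝ} (hB : IsOpen B) (ha : ContDiffOn ℝ ∞ a B)
    (hy : y ∈ B) (k : ℤ) (p : ℕ) (hr : r < k) :
    Conormal r y (fun z => a (bdPart z) * z 0 ^ k * Real.log (z 0) ^ p) := by
  have h := ((conormal_comp_bdPart hB ha hy).mul (conormal_zpow k)).mul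
    (conormal_log_pow (r := r - k) (by linarith) p)
  exact h.mono (by linarith)

theorem conormal_term_zero {a : BdCoord d → ℝ} (hB : IsOpen B) (ha : ContDiffOn ℝ ∞ a B)
    (hy : y ∈ B) (k : ℤ) : Conormal k y (fun z => a (bdPart z) * z 0 ^ k) := by
  simpa using (conormal_comp_bdPart hB ha hy).mul (conormal_zpow k)

/-! ### Bounded finite sums of terms, and their derivatives along `x∂_s` -/

/-- The function `a(y) x^k (log x)^p`. -/
def phgTerm (k p : ℕ) (a : BdCoord d → ℝ) (z : Coord d) : ℝ :=
  a (bdPart z) * z 0 ^ k * Real.log (z 0) ^ p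

/-- The finite sums of terms `a(y) x^k (log x)^p` that are bounded at `x = 0`. -/
def finiteExpansions (B : Set (BdCoord d)) : AddSubmonoid (Coord d → ℝ) :=
  AddSubmonoid.closure {e | ∃ k p a, ContDiffOn ℝ ∞ a B ∧ (k = 0 → p = 0) ∧ e = phgTerm k p a}

theorem phgTerm_mem {k p : ℕ} {a : BdCoord d → ℝ} (ha : ContDiffOn ℝ ∞ a B)
    (h : k = 0 → p = 0) : phgTerm k p a ∈ finiteExpansions B :=
  AddSubmonoid.subset_closure ⟨k, p, a, ha, h, rfl⟩

theorem finiteExpansions_induction {P : (e : Coord d → ℝ) → e ∈ finiteExpansions B → Prop}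
    (hterm : ∀ k p a (ha : ContDiffOn ℝ ∞ a B) (h : k = 0 → p = 0),
      P (phgTerm k p a) (phgTerm_mem ha h))
    (hzero : P 0 (zero_mem _))
    (hadd : ∀ e e' (he : e ∈ finiteExpansions B) (he' : e' ∈ finiteExpansions B),
      P e he → P e' he' → P (e + e') (add_mem he he')) {e : Coord d → ℝ}
    (he : e ∈ finiteExpansions B) : P e he := by
  refine AddSubmonoid.closure_induction ?_ hzero hadd he
  rintro _ ⟨k, p, a, ha, h, rfl⟩
  exact hterm k p a ha h

theorem mul_mem_finiteExpansions {e e' : Coord d → ℝ} (he : e ∈ finiteExpansions B)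
    (he' : e' ∈ finiteExpansions B) : e * e' ∈ finiteExpansions B := by
  induction he using finiteExpansions_induction with
  | hzero => simp [zero_mem]
  | hadd e₁ e₂ _ _ h h' => rw [add_mul]; exact add_mem h h'
  | hterm k p a ha h =>
    induction he' using finiteExpansions_induction with
    | hzero => simp [zero_mem]
    | hadd e₁ e₂ _ _ h h' => rw [mul_add]; exact add_mem h h'
    | hterm k' p' a' ha' h' =>
      have : phgTerm k p a * phgTerm k' p' a' = phgTerm (k + k') (p + p') (a * a') := by
        ext z; simp only [phgTerm, Pi.mul_apply]; ring
      rw [this]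
      -- If `k + k' = 0` then both exponents vanish, and with them both powers of the logarithm.
      exact phgTerm_mem (ha.mul ha') (by omega)

/-- The terms with `k = 0` carry no logarithm and add up to `a(y)`; all others have `k ≥ 1` and so
are conormal of order `1/2`. -/
theorem finiteExpansions_leading (hB : IsOpen B) {e : Coord d → ℝ}
    (he : e ∈ finiteExpansions B) : ∃ a, ContDiffOn ℝ ∞ a B ∧
      ∀ y ∈ B, Conormal (1 / 2) y (fun z => e z - a (bdPart z)) := by
  induction he using finiteExpansions_induction with
  | hzero => exact ⟨0, contDiffOn_const, fun y _ => by simpa using conormal_zero⟩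
  | hadd e₁ e₂ _ _ h h' =>
    obtain ⟨a, ha, h⟩ := h
    obtain ⟨a', ha', h'⟩ := h'
    refine ⟨a + a', ha.add ha', fun y hy => ((h y hy).add (h' y hy)).congr ?_⟩
    exact Eventually.of_forall fun z => by simp only [Pi.add_apply]; ring
  | hterm k p a ha h =>
    by_cases hk : k = 0
    · obtain rfl := h hk
      subst hk
      refine ⟨a, ha, fun y _ => ?_⟩
      simpa [phgTerm] using conormal_zero
    · refine ⟨0, contDiffOn_const, fun y hy => ?_⟩
      have hk' : (1 / 2 : ℝ) < ((k : ℤ) : ℝ) := by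
        have : (1 : ℝ) ≤ k := by exact_mod_cast Nat.one_le_iff_ne_zero.2 hk
        push_cast; linarith
      simpa [phgTerm] using conormal_term hB ha hy k p hk'

theorem conormal_of_leading (hB : IsOpen B) {a : BdCoord d → ℝ} (ha : ContDiffOn ℝ ∞ a B)
    (hy : y ∈ B) (h : Conormal (1 / 2) y (fun z => f z - a (bdPart z))) : Conormal 0 y f := by
  simpa using (h.mono (by norm_num)).add (conormal_comp_bdPart hB ha hy)

theorem conormal_of_mem (hB : IsOpen B) {e : Coord d → ℝ} (he : e ∈ finiteExpansions B)
    (hy : y ∈ B) : Conormal 0 y e := by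
  obtain ⟨a, ha, h⟩ := finiteExpansions_leading hB he
  exact conormal_of_leading hB ha hy (h y hy)

/-- The vector fields `x ∂_s`. -/
def zeroDeriv (s : Fin (d + 1)) (f : Coord d → ℝ) (z : Coord d) : ℝ := z 0 * pd s f z

theorem zeroDeriv_eq (s : Fin (d + 1)) (f : Coord d → ℝ) (z : Coord d) :
    zeroDeriv s f z = z 0 ^ (if s = 0 then 0 else 1) * bDeriv s f z := by
  by_cases hs : s = 0 <;> simp [zeroDeriv, bDeriv, hs]

theorem zeroDeriv_add {z : Coord d} (s : Fin (d + 1)) (hf : DifferentiableAt ℝ f z)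
    (hg : DifferentiableAt ℝ g z) :
    zeroDeriv s (fun w => f w + g w) z = zeroDeriv s f z + zeroDeriv s g z := by
  simp only [zeroDeriv_eq, bDeriv_add s hf hg]; ring

theorem zeroDeriv_sub {z : Coord d} (s : Fin (d + 1)) (hf : DifferentiableAt ℝ f z)
    (hg : DifferentiableAt ℝ g z) :
    zeroDeriv s (fun w => f w - g w) z = zeroDeriv s f z - zeroDeriv s g z := by
  simp only [zeroDeriv, pd, fderiv_fun_sub hf hg, _root_.sub_apply]; ring

theorem Conormal.zeroDeriv (hf : Conormal r y f) (s : Fin (d + 1)) :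
    Conormal r y (AsympHyp.zeroDeriv s f) := by
  have h := ((conormal_zpow (y := y) ((if s = 0 then 0 else 1 : ℕ) : ℤ)).mono
    (r' := 0) (by positivity)).mul (hf.bDeriv s)
  simp only [zero_add, zpow_natCast] at h
  convert h using 2
  exact zeroDeriv_eq _ _ _

/-- Equality is claimed only near the boundary points in `B`, since the coefficients are
differentiable only on `B`. -/
theorem zeroDeriv_mem (hB : IsOpen B) (s : Fin (d + 1)) {e : Coord d → ℝ}
    (he : e ∈ finiteExpansions B) :
    ∃ e' ∈ finiteExpansions B, ∀ y ∈ B, zeroDeriv s e =ᶠ[bdFilter y] e' := by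
  induction he using finiteExpansions_induction with
  | hzero =>
    refine ⟨0, zero_mem _, fun y _ => Eventually.of_forall fun z => ?_⟩
    simp [zeroDeriv, pd]
  | hadd e₁ e₂ he₁ he₂ h h' =>
    obtain ⟨a, ha, h⟩ := h
    obtain ⟨a', ha', h'⟩ := h'
    refine ⟨a + a', add_mem ha ha', fun y hy => ?_⟩
    filter_upwards [h y hy, h' y hy, (conormal_of_mem hB he₁ hy).smooth,
      (conormal_of_mem hB he₂ hy).smooth] with z h1 h2 h3 h4
    rw [Pi.add_apply, ← h1, ← h2]
    exact zeroDeriv_add s (differentiableAt_of_smooth h3) (differentiableAt_of_smooth h4)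
  | hterm k p a ha h =>
    -- For `s = 0` the first term vanishes by `bdDeriv_zero`, and the other two come from `x∂_x`
    -- acting on `x^k` and on the logarithm. When `p = 0` the truncated exponent `p - 1` is
    -- harmless, as the coefficient is `p * a`.
    refine ⟨phgTerm (k + if s = 0 then 0 else 1) p (bdDeriv s a) + (if s = 0 then
      phgTerm k p (fun y => k * a y) + phgTerm k (p - 1) (fun y => p * a y) else 0),
      add_mem ?_ ?_, fun y hy => ?_⟩
    · exact phgTerm_mem (ContDiffOn.bdDeriv hB ha s) fun h0 => h (Nat.eq_zero_of_add_eq_zero h0).1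
    · split_ifs
      · exact add_mem (phgTerm_mem (contDiffOn_const.mul ha) h)
          (phgTerm_mem (contDiffOn_const.mul ha) fun hk => by simp [h hk])
      · exact zero_mem _
    · filter_upwards [eventually_posHalf y, eventually_bdPart_mem hB hy] with z hz hzB
      have ha' : DifferentiableAt ℝ a (bdPart z) :=
        (ha.contDiffAt (hB.mem_nhds hzB)).differentiableAt (by simp)
      have ha'' : DifferentiableAt ℝ (fun w : Coord d => a (bdPart w)) z :=
        DifferentiableAt.comp z ha' (contDiff_bdPart.contDiffAt.differentiableAt (by simp))
      have hh : HasDerivAt (fun x : ℝ => x ^ k * Real.log x ^ p)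
          (k * z 0 ^ (k - 1) * Real.log (z 0) ^ p +
            z 0 ^ k * (p * Real.log (z 0) ^ (p - 1) * (z 0)⁻¹)) (z 0) :=
        (hasDerivAt_pow k (z 0)).mul ((Real.hasDerivAt_log hz.ne').pow p)
      have e1 : phgTerm k p a = fun w => a (bdPart w) * (w 0 ^ k * Real.log (w 0) ^ p) := by
        ext w; simp only [phgTerm]; ring
      have hh' : DifferentiableAt ℝ (fun w : Coord d => w 0 ^ k * Real.log (w 0) ^ p) z :=
        DifferentiableAt.comp (g := fun x : ℝ => x ^ k * Real.log x ^ p) z hh.differentiableAt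
          (differentiableAt_of_smooth (contDiffAt_coord 0))
      rw [zeroDeriv_eq, e1, bDeriv_mul s ha'' hh', bDeriv_comp_bdPart s ha',
        bDeriv_comp_coord_zero s hh]
      split_ifs with hs
      · simp only [phgTerm, Pi.add_apply, add_zero, pow_zero, one_mul]
        rcases k with _ | k
        · simp
          field_simp
        · simp only [Nat.add_sub_cancel]
          field_simp
          ring
      · simp only [phgTerm, Pi.add_apply, Pi.zero_apply]
        ring

end Elementary

/-! ### The algebra of bounded polyhomogeneous functions -/

section BoundedPhg

variable {d : ℕ} {y : BdCoord d} {f g : Coord d → ℝ} {r : ℝ} {B : Set (BdCoord d)}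

/-- `f` is approximated to every order at `x = 0` by bounded finite expansions with coefficients
that are smooth on `B`. -/
def IsBoundedPhg (B : Set (BdCoord d)) (f : Coord d → ℝ) : Prop :=
  ∀ N : ℕ, ∃ e ∈ finiteExpansions B, ∀ y ∈ B, Conormal N y (fun z => f z - e z)

theorem IsBoundedPhg.congr (hf : IsBoundedPhg B f) (h : ∀ y ∈ B, f =ᶠ[bdFilter y] g) :
    IsBoundedPhg B g := fun N => by
  obtain ⟨e, he, h'⟩ := hf N
  refine ⟨e, he, fun y hy => (h' y hy).congr ?_⟩
  filter_upwards [h y hy] with z hz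
  rw [hz]

theorem isBoundedPhg_of_mem {e : Coord d → ℝ} (he : e ∈ finiteExpansions B) :
    IsBoundedPhg B e := fun N => ⟨e, he, fun y _ => by simpa using conormal_zero⟩

theorem isBoundedPhg_comp_bdPart {a : BdCoord d → ℝ} (ha : ContDiffOn ℝ ∞ a B) :
    IsBoundedPhg B (fun z => a (bdPart z)) := by
  have h := isBoundedPhg_of_mem (phgTerm_mem (k := 0) (p := 0) ha fun _ => rfl)
  convert h using 2
  simp [phgTerm]

theorem isBoundedPhg_const (c : ℝ) : IsBoundedPhg B (fun _ => c) :=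
  isBoundedPhg_comp_bdPart (a := fun _ => c) contDiffOn_const

theorem IsBoundedPhg.leading (hB : IsOpen B) (hf : IsBoundedPhg B f) :
    ∃ a, ContDiffOn ℝ ∞ a B ∧ ∀ y ∈ B, Conormal (1 / 2) y (fun z => f z - a (bdPart z)) := by
  obtain ⟨e, he, h⟩ := hf 1
  obtain ⟨a, ha, h'⟩ := finiteExpansions_leading hB he
  refine ⟨a, ha, fun y hy => ?_⟩
  simpa using ((h y hy).mono (r' := 1 / 2) (by norm_num)).add (h' y hy)

theorem IsBoundedPhg.conormal (hB : IsOpen B) (hf : IsBoundedPhg B f) (hy : y ∈ B) :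
    Conormal 0 y f := by
  obtain ⟨a, ha, h⟩ := hf.leading hB
  exact conormal_of_leading hB ha hy (h y hy)

theorem IsBoundedPhg.add (hf : IsBoundedPhg B f) (hg : IsBoundedPhg B g) :
    IsBoundedPhg B (fun z => f z + g z) := fun N => by
  obtain ⟨e, he, h⟩ := hf N
  obtain ⟨e', he', h'⟩ := hg N
  refine ⟨e + e', add_mem he he', fun y hy => ((h y hy).add (h' y hy)).congr ?_⟩
  exact Eventually.of_forall fun z => by simp only [Pi.add_apply]; ring

theorem IsBoundedPhg.mul (hB : IsOpen B) (hf : IsBoundedPhg B f) (hg : IsBoundedPhg B g) :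
    IsBoundedPhg B (fun z => f z * g z) := fun N => by
  obtain ⟨e, he, h⟩ := hf N
  obtain ⟨e', he', h'⟩ := hg N
  refine ⟨e * e', mul_mem_finiteExpansions he he', fun y hy => ?_⟩
  -- The error splits as `f g - e e' = f (g - e') + (f - e) e'`, with one bounded factor in each
  -- product.
  have h1 := (hf.conormal hB hy).mul (h' y hy)
  have h2 := (h y hy).mul (conormal_of_mem hB he' hy)
  rw [zero_add] at h1
  rw [add_zero] at h2
  exact (h1.add h2).congr (Eventually.of_forall fun z => by simp only [Pi.mul_apply]; ring)

theorem IsBoundedPhg.sum {ι : Type*} (s : Finset ι) {F : ι → Coord d → ℝ}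
    (h : ∀ i ∈ s, IsBoundedPhg B (F i)) : IsBoundedPhg B (fun z => ∑ i ∈ s, F i z) := by
  classical
  induction s using Finset.induction_on with
  | empty => simpa using isBoundedPhg_const 0
  | insert i s hi ih =>
    simp only [Finset.sum_insert hi]
    exact (h i (by simp)).add (ih fun j hj => h j (by simp [hj]))

theorem IsBoundedPhg.pow (hB : IsOpen B) (hf : IsBoundedPhg B f) (k : ℕ) :
    IsBoundedPhg B (fun z => f z ^ k) := by
  induction k with
  | zero => simpa using isBoundedPhg_const 1
  | succ k ih => simpa only [pow_succ] using ih.mul hB hf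

theorem IsBoundedPhg.zeroDeriv (hB : IsOpen B) (hf : IsBoundedPhg B f) (s : Fin (d + 1)) :
    IsBoundedPhg B (zeroDeriv s f) := fun N => by
  obtain ⟨e, he, h⟩ := hf N
  obtain ⟨e', he', h'⟩ := zeroDeriv_mem hB s he
  refine ⟨e', he', fun y hy => ((h y hy).zeroDeriv s).congr ?_⟩
  filter_upwards [h' y hy, (hf.conormal hB hy).smooth, (conormal_of_mem hB he hy).smooth]
    with z h1 h2 h3
  rw [zeroDeriv_sub s (differentiableAt_of_smooth h2) (differentiableAt_of_smooth h3), h1]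

theorem Conormal.tendsto_zero (hf : Conormal r y f) (hr : 0 < r) :
    Tendsto f (bdFilter y) (𝓝 0) := by
  refine hf.isBigO.trans_tendsto ?_
  have h : Tendsto (fun x : ℝ => x ^ r) (𝓝[>] 0) (𝓝 0) := by
    have := (Real.continuousAt_rpow_const 0 r (Or.inr hr.le)).tendsto
    rw [Real.zero_rpow hr.ne'] at this
    exact this.mono_left nhdsWithin_le_nhds
  exact h.comp (tendsto_coord_zero y)

/-- `1 / (1 + u)` for `u` vanishing at the boundary, by the geometric series. -/
theorem IsBoundedPhg.inv_one_add (hB : IsOpen B) {u : Coord d → ℝ} (hu : IsBoundedPhg B u)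
    (hu0 : ∀ y ∈ B, Conormal (1 / 2) y u) : IsBoundedPhg B (fun z => (1 + u z)⁻¹) := fun N => by
  have hneg : IsBoundedPhg B (fun z => -u z) := by
    simpa using (isBoundedPhg_const (-1)).mul hB hu
  -- As `u` has order `1/2`, taking `2N` terms leaves the remainder `(-u)^(2N) / (1 + u)` of order
  -- `N`.
  have hS : IsBoundedPhg B (fun z => ∑ j ∈ Finset.range (2 * N), (-u z) ^ j) :=
    IsBoundedPhg.sum _ fun j _ => hneg.pow hB j
  obtain ⟨e, he, h⟩ := hS N
  refine ⟨e, he, fun y hy => ?_⟩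
  have ht : Tendsto (fun z => 1 + u z) (bdFilter y) (𝓝 1) := by
    simpa using ((hu0 y hy).tendsto_zero (by norm_num)).const_add 1
  have hne : ∀ᶠ z in bdFilter y, 1 + u z ≠ 0 := ht.eventually_ne one_ne_zero
  have hinv : Conormal 0 y (fun z => (1 + u z)⁻¹) := by
    refine Conormal.inv ((conormal_const le_rfl 1).add (hu.conormal hB hy)) hne ?_
    exact (ht.inv₀ one_ne_zero).isBigO_one ℝ
  have h1 := ((hu0 y hy).neg.pow (2 * N)).mul hinv
  refine ((h1.mono (r' := N) (by push_cast; linarith)).add (h y hy)).congr ?_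
  filter_upwards [hne] with z hz
  have hg := mul_neg_geom_sum (-u z) (2 * N)
  rw [sub_neg_eq_add] at hg
  have : ∑ j ∈ Finset.range (2 * N), (-u z) ^ j = (1 - (-u z) ^ (2 * N)) * (1 + u z)⁻¹ := by
    rw [← hg]; field_simp
  rw [this]; ring

/-- The nonzero limits show that the leading coefficient `a` has no zero. Then `f = a (1 + u)` with
`u = (f - a) / a` vanishing at the boundary, and the geometric series applies. -/
theorem IsBoundedPhg.inv (hB : IsOpen B) (hf : IsBoundedPhg B f)
    (h0 : ∀ y ∈ B, ∃ c ≠ 0, Tendsto f (bdFilter y) (𝓝 c)) :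
    IsBoundedPhg B (fun z => (f z)⁻¹) := by
  obtain ⟨a, ha, h⟩ := hf.leading hB
  have ha0 : ∀ y ∈ B, a y ≠ 0 := fun y hy => by
    obtain ⟨c, hc, hfc⟩ := h0 y hy
    have h1 := hfc.sub ((h y hy).tendsto_zero (by norm_num))
    simp only [sub_sub_cancel, sub_zero] at h1
    have h2 : Tendsto (fun z : Coord d => a (bdPart z)) (bdFilter y) (𝓝 (a y)) :=
      ((ha.contDiffAt (hB.mem_nhds hy)).continuousAt.tendsto).comp (tendsto_bdPart y)
    rwa [tendsto_nhds_unique h2 h1]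
  have hainv : ContDiffOn ℝ ∞ (fun y => (a y)⁻¹) B := ha.inv ha0
  have hA := isBoundedPhg_comp_bdPart hainv
  have hneg : ContDiffOn ℝ ∞ (fun y => -a y) B := ha.neg
  have hu : IsBoundedPhg B (fun z => (f z + -a (bdPart z)) * (a (bdPart z))⁻¹) :=
    (hf.add (isBoundedPhg_comp_bdPart hneg)).mul hB hA
  have hu0 : ∀ y ∈ B, Conormal (1 / 2) y
      (fun z => (f z + -a (bdPart z)) * (a (bdPart z))⁻¹) := fun y hy => by
    simpa [sub_eq_add_neg] using (h y hy).mul (conormal_comp_bdPart hB hainv hy)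
  refine (hA.mul hB (hu.inv_one_add hB hu0)).congr fun y hy => ?_
  filter_upwards [eventually_bdPart_mem hB hy] with z hz
  have := ha0 _ hz
  rw [← mul_inv]
  congr 1
  field_simp
  ring

end BoundedPhg

/-! ### Uniqueness of expansions -/

section Uniqueness

open Polynomial

theorem tendsto_rpow_mul_eval_log (q : ℝ[X]) {s : ℝ} (hs : 0 < s) :
    Tendsto (fun x : ℝ => x ^ s * q.eval (Real.log x)) (𝓝[>] 0) (𝓝 0) := by
  induction q using Polynomial.induction_on' with
  | add p q hp hq => simpa [mul_add] using hp.add hq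
  | monomial n a =>
    have h := isLittleO_abs_log_rpow_rpow_nhdsGT_zero (s := -s) n (by linarith)
    have h2 := h.tendsto_div_nhds_zero
    have h3 := (tendsto_zero_iff_norm_tendsto_zero.1 h2).const_mul |a|
    rw [mul_zero] at h3
    refine tendsto_zero_iff_norm_tendsto_zero.2 (h3.congr' ?_)
    filter_upwards [self_mem_nhdsWithin] with x hx
    have hx : 0 < x := hx
    rw [Real.rpow_neg hx.le, Real.rpow_natCast]
    simp [eval_monomial, abs_of_pos (Real.rpow_pos_of_pos hx s)]
    ring

/-- As `log x → -∞`, a nonconstant polynomial in `log x` is unbounded; substituting `-X` turns this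
into a limit at `+∞`. -/
theorem natDegree_eq_zero_of_eval_log_bounded {q : ℝ[X]}
    (h : (fun x : ℝ => q.eval (Real.log x)) =O[𝓝[>] 0] fun _ => (1 : ℝ)) : q.natDegree = 0 := by
  by_contra hq
  have hdeg : 0 < (q.comp (-X)).degree := by
    rw [← natDegree_pos_iff_degree_pos, natDegree_comp]
    simpa using Nat.pos_of_ne_zero hq
  have h1 := (abs_tendsto_atTop _ hdeg).comp
    (tendsto_neg_atBot_atTop.comp Real.tendsto_log_nhdsGT_zero)
  have h2 : Tendsto (fun x : ℝ => |q.eval (Real.log x)|) (𝓝[>] 0) atTop := by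
    refine h1.congr fun x => ?_
    simp [eval_comp]
  exact (not_isBoundedUnder_of_tendsto_atTop h2) ((isBigO_one_iff ℝ).1 h)

/-- The coefficients of an expansion in `x^k (log x)^p` that is `O(x^r)` vanish for `k < r`, and
for `k = r` unless `p = 0`. -/
theorem coeff_eq_zero_of_isBigO (s : Finset ℤ) (q : ℤ → ℝ[X]) {r : ℝ}
    (h : (fun x : ℝ => ∑ k ∈ s, x ^ k * (q k).eval (Real.log x)) =O[𝓝[>] 0] fun x => x ^ r) :
    ∀ k ∈ s, (k : ℝ) ≤ r → (q k).natDegree = 0 ∧ ((k : ℝ) < r → q k = 0) := by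
  by_contra! hcon
  -- The set of exponents violating the conclusion; its least element `k` gives the contradiction.
  have hex : (s.filter fun k : ℤ => (k : ℝ) ≤ r ∧ ((q k).natDegree = 0 →
      (k : ℝ) < r ∧ q k ≠ 0)).Nonempty := by
    obtain ⟨k, hk, hkr, h'⟩ := hcon
    exact ⟨k, Finset.mem_filter.2 ⟨hk, hkr, h'⟩⟩
  obtain ⟨k, hk, hmin⟩ := Finset.exists_min_image _ id hex
  obtain ⟨hks, hkr, hk'⟩ := Finset.mem_filter.1 hk
  -- A nonzero `q j` with `j < k ≤ r` would violate the conclusion at a smaller exponent.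
  have hlow : ∀ j ∈ s, j < k → q j = 0 := fun j hj hjk => by
    by_contra hne
    have hjr : (j : ℝ) < r := lt_of_lt_of_le (by exact_mod_cast hjk) hkr
    have := hmin j (Finset.mem_filter.2 ⟨hj, hjr.le, fun _ => ⟨hjr, hne⟩⟩)
    simp only [id] at this
    omega
  have hrest : Tendsto (fun x : ℝ => ∑ j ∈ s.erase k,
      x ^ ((j - k : ℤ) : ℝ) * (q j).eval (Real.log x)) (𝓝[>] 0) (𝓝 0) := by
    suffices h : ∀ j ∈ s.erase k, Tendsto (fun x : ℝ =>
        x ^ ((j - k : ℤ) : ℝ) * (q j).eval (Real.log x)) (𝓝[>] 0) (𝓝 0) by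
      simpa using tendsto_finsetSum _ h
    intro j hj
    obtain ⟨hjk, hjs⟩ := Finset.mem_erase.1 hj
    rcases lt_or_gt_of_ne hjk with hlt | hgt
    · simp [hlow j hjs hlt]
    · exact tendsto_rpow_mul_eval_log _ (Int.cast_pos.2 (sub_pos.2 hgt))
  -- After division by `x^k` the terms above `k` tend to zero, so `q k` evaluated at `log x` is
  -- bounded, hence constant; if moreover `k < r`, the constant is zero.
  have hF : (fun x : ℝ => (q k).eval (Real.log x) + ∑ j ∈ s.erase k,
      x ^ ((j - k : ℤ) : ℝ) * (q j).eval (Real.log x)) =O[𝓝[>] 0] fun x => x ^ (r - k) := by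
    have h1 := (isBigO_refl (fun x : ℝ => x ^ (-k : ℝ)) (𝓝[>] 0)).mul h
    refine h1.congr' ?_ ?_
    · filter_upwards [self_mem_nhdsWithin] with x hx
      have hx : 0 < x := hx
      rw [← Finset.add_sum_erase s _ hks, mul_add, Finset.mul_sum]
      congr 1
      · rw [Real.rpow_neg hx.le, Real.rpow_intCast]
        field_simp
      · refine Finset.sum_congr rfl fun j _ => ?_
        rw [← mul_assoc, ← Real.rpow_intCast x j, ← Real.rpow_add hx]
        push_cast
        ring_nf
    · filter_upwards [self_mem_nhdsWithin] with x hx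
      rw [← Real.rpow_add hx]
      ring_nf
  have hone : (fun x : ℝ => x ^ (r - k)) =O[𝓝[>] 0] fun _ => (1 : ℝ) := by
    simpa using isBigO_rpow_of_le (sub_nonneg.2 hkr)
  have hq : (fun x : ℝ => (q k).eval (Real.log x)) =O[𝓝[>] 0] fun _ => (1 : ℝ) := by
    have := (hF.trans hone).sub (hrest.isBigO_one ℝ)
    simpa using this
  have hdeg := natDegree_eq_zero_of_eval_log_bounded hq
  obtain ⟨hlt, hne⟩ := hk' hdeg
  have h0 : Tendsto (fun x : ℝ => (q k).eval (Real.log x)) (𝓝[>] 0) (𝓝 0) := by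
    have h1 : Tendsto (fun x : ℝ => x ^ (r - k)) (𝓝[>] 0) (𝓝 0) := by
      simpa using tendsto_rpow_mul_eval_log 1 (sub_pos.2 hlt)
    simpa using (hF.trans_tendsto h1).sub hrest
  rw [eq_C_of_natDegree_eq_zero hdeg] at h0 hne
  simp only [eval_C] at h0
  have := tendsto_nhds_unique h0 tendsto_const_nhds
  rw [← this] at hne
  simp at hne

end Uniqueness

/-! ### Expansions of polyhomogeneous functions -/

section Expansions

open Polynomial

variable {d : ℕ} {y : BdCoord d} {f f' : Coord d → ℝ} {r : ℝ} {B : Set (BdCoord d)}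
  {a a' : ℤ → ℕ → BdCoord d → ℝ} {k₀ k₀' N N' : ℤ} {P P' : ℤ → ℕ}

/-- Vanishing is required only for `k ≤ N'`. With `N = N'` nothing is asked of the later
coefficients, so infinite expansions are allowed. -/
theorem phgSum_extend {z : Coord d} (hk : k₀' ≤ k₀) (hP : ∀ k, P k ≤ P' k) (hN : N ≤ N')
    (h : ∀ k p, k ≤ N' → (k < k₀ ∨ P k < p ∨ N < k) → a k p (bdPart z) = 0) :
    phgSum k₀ P a N z = phgSum k₀' P' a N' z := by
  have h1 : phgSum k₀ P a N z = phgSum k₀ P' a N z := by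
    refine Finset.sum_congr rfl fun k hk => Finset.sum_subset ?_ fun p _ hp => ?_
    · exact Finset.range_subset_range.2 (Nat.succ_le_succ (hP k))
    · rw [h k p ((Finset.mem_Icc.1 hk).2.trans hN) (Or.inr (Or.inl (by simpa using hp)))]
      simp
  rw [h1]
  refine Finset.sum_subset (Finset.Icc_subset_Icc hk hN) fun k hk hk' => ?_
  refine Finset.sum_eq_zero fun p _ => ?_
  have hk2 := (Finset.mem_Icc.1 hk).2
  rw [h k p hk2, zero_mul, zero_mul]
  rw [Finset.mem_Icc] at hk'
  omega

theorem phgSum_sub_phgSum {z : Coord d}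
    (h : ∀ k p, k ≤ max N N' → (k < k₀ ∨ P k < p ∨ N < k) → a k p (bdPart z) = 0)
    (h' : ∀ k p, k ≤ max N N' → (k < k₀' ∨ P' k < p ∨ N' < k) → a' k p (bdPart z) = 0) :
    phgSum k₀ P a N z - phgSum k₀' P' a' N' z =
      phgSum (min k₀ k₀') (fun k => max (P k) (P' k)) (fun k p y => a k p y - a' k p y)
        (max N N') z := by
  rw [phgSum_extend (min_le_left k₀ k₀') (fun k => le_max_left (P k) (P' k)) (le_max_left N N') h,
    phgSum_extend (min_le_right k₀ k₀') (fun k => le_max_right (P k) (P' k)) (le_max_right N N')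
      h', phgSum, phgSum, phgSum, ← Finset.sum_sub_distrib]
  refine Finset.sum_congr rfl fun k _ => ?_
  rw [← Finset.sum_sub_distrib]
  exact Finset.sum_congr rfl fun p _ => by ring

theorem phgSum_linePoint (x : ℝ) : phgSum k₀ P a N (linePoint y x) =
    ∑ k ∈ Finset.Icc k₀ N, x ^ k *
      (∑ p ∈ Finset.range (P k + 1), monomial p (a k p y)).eval (Real.log x) := by
  refine Finset.sum_congr rfl fun k _ => ?_
  rw [eval_finsetSum, Finset.mul_sum]
  refine Finset.sum_congr rfl fun p _ => ?_
  rw [bdPart_linePoint, linePoint_zero, eval_monomial]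
  ring

/-- On a normal ray the sum is one of powers of `x` times polynomials in `log x`, so the
one-variable uniqueness applies at each `y` separately. -/
theorem coeff_eq_zero_of_phgSum_isBigO
    (h : (fun x => phgSum k₀ P a N (linePoint y x)) =O[𝓝[>] 0] fun x : ℝ => x ^ r)
    (h0 : ∀ k p, k ≤ N → (k < k₀ ∨ P k < p) → a k p y = 0) {k : ℤ} (hk : k ≤ N)
    (hkr : (k : ℝ) ≤ r) {p : ℕ} (hp : (k : ℝ) < r ∨ p ≠ 0) : a k p y = 0 := by
  by_cases hout : k < k₀ ∨ P k < p
  · exact h0 k p hk hout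
  push Not at hout
  have h1 := h
  simp only [phgSum_linePoint] at h1
  obtain ⟨hdeg, hz⟩ := coeff_eq_zero_of_isBigO _ _ h1 k (Finset.mem_Icc.2 ⟨hout.1, hk⟩) hkr
  have hc : (∑ p ∈ Finset.range (P k + 1), monomial p (a k p y)).coeff p = a k p y := by
    rw [finsetSum_coeff, Finset.sum_eq_single p]
    · simp
    · intro q _ hq
      rw [coeff_monomial, if_neg hq]
    · intro hp'
      simp only [Finset.mem_range] at hp'
      omega
  rw [← hc]
  rcases hp with hlt | hp
  · rw [hz hlt, coeff_zero]
  · exact coeff_eq_zero_of_natDegree_lt (by omega)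

theorem conormal_phgSum (hB : IsOpen B) (hy : y ∈ B) (ha : ∀ k p, ContDiffOn ℝ ∞ (a k p) B)
    (h : ∀ k ∈ Finset.Icc k₀ N, ∀ p, (∀ y ∈ B, a k p y = 0) ∨ r < k ∨ p = 0 ∧ r ≤ k) :
    Conormal r y (phgSum k₀ P a N) := by
  refine Conormal.sum _ fun k hk => Conormal.sum _ fun p _ => ?_
  rcases h k hk p with h0 | h0 | ⟨rfl, h0⟩
  · refine conormal_zero.congr ?_
    filter_upwards [eventually_bdPart_mem hB hy] with z hz
    rw [h0 _ hz, zero_mul, zero_mul]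
  · exact conormal_term hB (ha k p) hy k p h0
  · simpa using (conormal_term_zero hB (ha k 0) hy k).mono h0

/-! ### Full expansions and approximations to finite order, on relatively open sets -/

/-- `D` is relatively open in the closed half-space. -/
def IsRelOpen (D : Set (Coord d)) : Prop := ∃ O, IsOpen O ∧ D = O ∩ {z | 0 ≤ z 0}

variable {D D' : Set (Coord d)}

theorem continuous_bdPoint : Continuous (bdPoint : BdCoord d → Coord d) := by
  refine (PiLp.continuous_toLp 2 _).comp (continuous_pi fun i => ?_)
  refine Fin.cases ?_ (fun i => ?_) i
  · simpa using continuous_const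
  · simp only [Fin.cons_succ]
    fun_prop

theorem bdPoint_zero (y : BdCoord d) : bdPoint y 0 = 0 := rfl

theorem IsRelOpen.isOpen_bdSlice (hD : IsRelOpen D) : IsOpen (bdSlice D) := by
  obtain ⟨O, hO, rfl⟩ := hD
  have : bdSlice (O ∩ {z | 0 ≤ z 0}) = bdPoint ⁻¹' O := by
    ext y; simp [bdSlice, bdPoint_zero]
  rw [this]
  exact hO.preimage continuous_bdPoint

theorem IsRelOpen.isOpen_inter (hD : IsRelOpen D) : IsOpen (D ∩ posHalf d) := by
  obtain ⟨O, hO, rfl⟩ := hD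
  have : O ∩ {z : Coord d | 0 ≤ z 0} ∩ posHalf d = O ∩ posHalf d := by
    ext z
    simp only [posHalf, mem_inter_iff, mem_ofPred_eq]
    exact ⟨fun h => ⟨h.1.1, h.2⟩, fun h => ⟨⟨h.1, h.2.le⟩, h.2⟩⟩
  rw [this]
  exact hO.inter isOpen_posHalf

theorem IsRelOpen.eventually_mem (hD : IsRelOpen D) (hy : y ∈ bdSlice D) :
    ∀ᶠ z in bdFilter y, z ∈ D ∩ posHalf d := by
  obtain ⟨O, hO, rfl⟩ := hD
  have hy : bdPoint y ∈ O := hy.1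
  filter_upwards [bdFilter_le y (hO.mem_nhds hy), eventually_posHalf y] with z h1 h2
  exact ⟨⟨h1, le_of_lt h2⟩, h2⟩

theorem IsRelOpen.eventually_contDiffAt (hD : IsRelOpen D) (hy : y ∈ bdSlice D)
    (hf : ContDiffOn ℝ ∞ f (D ∩ posHalf d)) : ∀ᶠ z in bdFilter y, ContDiffAt ℝ ∞ f z := by
  filter_upwards [hD.eventually_mem hy] with z hz
  exact hf.contDiffAt (hD.isOpen_inter.mem_nhds hz)

/-- The remainders of a polyhomogeneous expansion are conormal. -/
theorem HasPhgExpansion.exists_conormal (hD : IsRelOpen D) (h : HasPhgExpansion D f a) :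
    ∃ (k₀ : ℤ) (P : ℤ → ℕ), (∀ k p, (k < k₀ ∨ P k < p) → ∀ y ∈ bdSlice D, a k p y = 0) ∧
      ∀ (N : ℤ), ∀ y ∈ bdSlice D, Conormal N y (fun z => f z - phgSum k₀ P a N z) := by
  obtain ⟨hf, ha, k₀, P, h0, hO⟩ := h
  refine ⟨k₀, P, h0, fun N y hy => conormal_of_iterBDeriv ?_ fun L => ?_⟩
  · have h1 : Conormal ((k₀ : ℝ) - 1) y (phgSum k₀ P a N) :=
      conormal_phgSum hD.isOpen_bdSlice hy ha fun k hk p => by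
        have : (k₀ : ℝ) ≤ k := by exact_mod_cast (Finset.mem_Icc.1 hk).1
        right; left; linarith
    filter_upwards [hD.eventually_contDiffAt hy hf, h1.smooth] with z h2 h3 using h2.sub h3
  · simpa only [Real.rpow_intCast, bdFilter] using hO N L y hy

/-- Boundedness makes the partial sum up to `k = 0` bounded, and uniqueness then removes the
negative powers and the logarithms at `x^0`. -/
theorem HasPhgExpansion.isBoundedPhg (hD : IsRelOpen D) (h : HasPhgExpansion D f a)
    (hb : ∀ y ∈ bdSlice D, f =O[bdFilter y] fun _ => (1 : ℝ)) : IsBoundedPhg (bdSlice D) f := by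
  obtain ⟨k₀, P, h0, hc⟩ := h.exists_conormal hD
  have ha := h.2.1
  have hB := hD.isOpen_bdSlice
  have hvan : ∀ k p, ¬(0 < k ∨ k = 0 ∧ p = 0) → ∀ y ∈ bdSlice D, a k p y = 0 := by
    intro k p hkp y hy
    have h1 : (fun z => phgSum k₀ P a 0 z) =O[bdFilter y] fun z => z 0 ^ (0 : ℝ) := by
      have h2 := (hc 0 y hy).isBigO
      simp only [Int.cast_zero, Real.rpow_zero] at h2 ⊢
      simpa using (hb y hy).sub h2
    refine coeff_eq_zero_of_phgSum_isBigO (h1.comp_tendsto (tendsto_linePoint y))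
      (fun k p _ hk => h0 k p hk y hy) (k := k) (by omega)
      (by exact_mod_cast (by omega : k ≤ 0)) ?_
    rcases lt_or_ge k 0 with hk | hk
    · exact Or.inl (by exact_mod_cast hk)
    · exact Or.inr (by omega)
  intro N
  refine ⟨∑ k ∈ Finset.Icc k₀ N, ∑ p ∈ Finset.range (P k + 1),
    if 0 < k ∨ k = 0 ∧ p = 0 then phgTerm k.toNat p (a k p) else 0, ?_, fun y hy => ?_⟩
  · refine sum_mem fun k _ => sum_mem fun p _ => ?_
    split_ifs with hk
    · exact phgTerm_mem (ha k p) fun hk0 => by omega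
    · exact zero_mem _
  · refine (hc N y hy).congr ?_
    filter_upwards [eventually_bdPart_mem hB hy] with z hz
    congr 1
    rw [phgSum, Finset.sum_apply]
    refine Finset.sum_congr rfl fun k _ => ?_
    rw [Finset.sum_apply]
    refine Finset.sum_congr rfl fun p _ => ?_
    split_ifs with hk
    · have : z 0 ^ k = z 0 ^ k.toNat := by
        rw [← zpow_natCast, Int.toNat_of_nonneg (by omega)]
      rw [phgTerm, this]
    · rw [hvan k p hk _ hz]; simp

/-- Collecting equal pairs `(k, p)` gives each pair a single coefficient, as comparison of two
approximations requires. -/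
theorem finiteExpansions_normalForm {e : Coord d → ℝ} (he : e ∈ finiteExpansions B) :
    ∃ (K : ℕ) (c : ℤ → ℕ → BdCoord d → ℝ), (∀ k p, ContDiffOn ℝ ∞ (c k p) B) ∧
      (∀ k p, (k < 0 ∨ K < p ∨ (K : ℤ) < k) → c k p = 0) ∧
      ∀ z, e z = phgSum 0 (fun _ => K) c K z := by
  induction he using finiteExpansions_induction with
  | hzero => exact ⟨0, fun _ _ => 0, fun _ _ => contDiffOn_const, by simp, by simp [phgSum]⟩
  | hadd e e' _ _ h h' =>
    obtain ⟨K, c, hc, h0, h⟩ := h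
    obtain ⟨K', c', hc', h0', h'⟩ := h'
    refine ⟨max K K', fun k p => c k p + c' k p, fun k p => (hc k p).add (hc' k p),
      fun k p hk => ?_, fun z => ?_⟩
    · dsimp only
      rw [h0 k p (by omega), h0' k p (by omega), add_zero]
    · have hl := phgSum_extend (z := z) (a := c) (k₀ := 0) (P' := fun _ => max K K')
        (N' := (max K K' : ℕ)) le_rfl (fun _ => le_max_left K K')
        (by push_cast; exact le_max_left _ _)
        (fun k p _ hk => by rw [h0 k p hk]; rfl)
      have hr := phgSum_extend (z := z) (a := c') (k₀ := 0) (P' := fun _ => max K K')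
        (N' := (max K K' : ℕ)) le_rfl (fun _ => le_max_right K K')
        (by push_cast; exact le_max_right _ _)
        (fun k p _ hk => by rw [h0' k p hk]; rfl)
      rw [Pi.add_apply, h, h', hl, hr, phgSum, phgSum, phgSum, ← Finset.sum_add_distrib]
      refine Finset.sum_congr rfl fun k _ => ?_
      rw [← Finset.sum_add_distrib]
      exact Finset.sum_congr rfl fun p _ => by simp only [Pi.add_apply]; ring
  | hterm k p a ha _ =>
    refine ⟨max k p, fun k' p' => if k' = k ∧ p' = p then a else 0, fun k' p' => ?_,
      fun k' p' hk => ?_, fun z => ?_⟩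
    · dsimp only
      split_ifs
      · exact ha
      · exact contDiffOn_const
    · dsimp only
      rw [if_neg]
      rintro ⟨rfl, rfl⟩
      omega
    · rw [phgSum, Finset.sum_eq_single (k : ℤ), Finset.sum_eq_single p]
      · simp [phgTerm]
      · intro p' _ hp
        simp [hp]
      · intro hp
        simp only [Finset.mem_range] at hp
        omega
      · intro k' _ hk
        simp [hk]
      · intro hk
        simp only [Finset.mem_Icc] at hk
        omega

/-- The approximations for different orders are chosen independently. Their difference is small, so
by uniqueness any two of order greater than `k` have the same coefficients of `x^k log^p x`; these
common values form the expansion. -/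
theorem IsBoundedPhg.isPhg (hD : IsRelOpen D) (hf : ContDiffOn ℝ ∞ f (D ∩ posHalf d))
    (h : IsBoundedPhg (bdSlice D) f) : IsPhg D f := by
  have hB := hD.isOpen_bdSlice
  have hex : ∀ M : ℕ, ∃ (K : ℕ) (c : ℤ → ℕ → BdCoord d → ℝ),
      (∀ k p, ContDiffOn ℝ ∞ (c k p) (bdSlice D)) ∧
      (∀ k p, (k < 0 ∨ K < p ∨ (K : ℤ) < k) → c k p = 0) ∧
      ∀ y ∈ bdSlice D, Conormal M y (fun z => f z - phgSum 0 (fun _ => K) c K z) := fun M => by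
    obtain ⟨e, he, hce⟩ := h M
    obtain ⟨K, c, hc, h0, heq⟩ := finiteExpansions_normalForm he
    exact ⟨K, c, hc, h0, fun y hy => (hce y hy).congr (Eventually.of_forall fun z => by
      simp only [heq])⟩
  choose K c hc h0 hcon using hex
  have hcons : ∀ (M M' : ℕ) (k : ℤ) (p : ℕ), k < M → k < M' → ∀ y ∈ bdSlice D,
      c M k p y = c M' k p y := by
    intro M M' k p hk hk' y hy
    by_cases hbig : max (K M : ℤ) (K M') < k
    · rw [h0 M k p (by omega), h0 M' k p (by omega)]
    have h1 := ((hcon M' y hy).mono (r' := min M M') (min_le_right _ _)).sub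
      ((hcon M y hy).mono (r' := min M M') (min_le_left _ _))
    have h2 := h1.isBigO
    have heq : ∀ z, f z - phgSum 0 (fun _ => K M') (c M') (K M') z -
        (f z - phgSum 0 (fun _ => K M) (c M) (K M) z) =
        phgSum (min 0 0) (fun _ => max (K M) (K M')) (fun k p y => c M k p y - c M' k p y)
          (max (K M : ℤ) (K M')) z := fun z => by
      rw [← phgSum_sub_phgSum (fun k p _ hk => by rw [h0 M k p hk]; rfl)
        (fun k p _ hk => by rw [h0 M' k p hk]; rfl)]
      ring
    simp only [heq] at h2
    have hlt : (k : ℝ) < min (M : ℝ) M' := lt_min (by exact_mod_cast hk) (by exact_mod_cast hk')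
    refine sub_eq_zero.1 (coeff_eq_zero_of_phgSum_isBigO (a := fun k p y => c M k p y - c M' k p y)
      (h2.comp_tendsto (tendsto_linePoint y)) (fun k p _ hk => ?_) (not_lt.1 hbig)
      hlt.le (p := p) (Or.inl hlt))
    rw [h0 M k p (by omega), h0 M' k p (by omega)]
    simp
  -- The coefficients at `k` are read off from the approximation of order `k.toNat + 1`, which
  -- exceeds `k`; for `k < 0` they are zero.
  refine ⟨fun k => c (k.toNat + 1) k, hf, fun k p => hc _ k p, 0, fun k => K (k.toNat + 1),
    fun k p hk y _ => by dsimp only at hk ⊢; rw [h0 _ k p (by omega)]; rfl, fun N L y hy => ?_⟩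
  have hN : (N : ℝ) ≤ (N.toNat + 1 : ℕ) := by exact_mod_cast (by omega : N ≤ (N.toNat + 1 : ℕ))
  set M := N.toNat + 1 with hM
  -- Up to `N` the coefficients cancel, and the remaining terms of the approximation have exponent
  -- greater than `N`.
  have hrest := conormal_phgSum (r := N) (P := fun k => max (K M) (K (k.toNat + 1)))
    (k₀ := min 0 0) (N := max (K M) N)
    (a := fun k p y => c M k p y - if k ≤ N then c (k.toNat + 1) k p y else 0) hB hy
    (fun k p => (hc M k p).sub (by split_ifs; exacts [hc _ k p, contDiffOn_const]))
    (fun k hk p => by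
      rcases le_or_gt k N with hkN | hkN
      · left
        intro y hy
        simp only [if_pos hkN]
        exact sub_eq_zero.2 (hcons M (k.toNat + 1) k p (by omega) (by omega) y hy)
      · exact Or.inr (Or.inl (by exact_mod_cast hkN)))
  have hres := (((hcon M y hy).mono hN).add hrest).congr
    (g := fun z => f z - phgSum 0 (fun k => K (k.toNat + 1)) (fun k => c (k.toNat + 1) k) N z)
    (Eventually.of_forall fun z => ?_)
  · simpa only [Real.rpow_intCast, bdFilter] using (hres.iterBDeriv L).isBigO
  -- Cutting the coefficients off above `N` leaves the sum unchanged and lets its range be extended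
  -- beyond `N`.
  · have htr : phgSum 0 (fun k => K (k.toNat + 1)) (fun k => c (k.toNat + 1) k) N z =
        phgSum 0 (fun k => K (k.toNat + 1))
          (fun k p y => if k ≤ N then c (k.toNat + 1) k p y else 0) N z := by
      refine Finset.sum_congr rfl fun k hk => Finset.sum_congr rfl fun p _ => ?_
      simp only [if_pos (Finset.mem_Icc.1 hk).2]
    dsimp only
    rw [htr, ← phgSum_sub_phgSum (fun k p _ hk => by rw [h0 M k p hk]; rfl) (fun k p _ hk => ?_)]
    · ring
    · split_ifs with hkN
      · rw [h0 _ k p (by omega)]; rfl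
      · rfl

theorem IsBoundedPhg.extendsContinuously (hD : IsRelOpen D)
    (hf : ContDiffOn ℝ ∞ f (D ∩ posHalf d)) (h : IsBoundedPhg (bdSlice D) f) :
    ExtendsContinuously D f := by
  obtain ⟨a, ha, hlead⟩ := h.leading hD.isOpen_bdSlice
  refine ⟨fun z => if 0 < z 0 then f z else a (bdPart z), fun z hz => ?_,
    fun z hz => if_pos hz.2⟩
  by_cases hz0 : 0 < z 0
  · have h1 : ContinuousAt f z := (hf.contDiffAt (hD.isOpen_inter.mem_nhds ⟨hz, hz0⟩)).continuousAt
    refine (h1.congr ?_).continuousWithinAt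
    filter_upwards [isOpen_posHalf.mem_nhds (show z ∈ posHalf d from hz0)] with w hw
    rw [if_pos (show 0 < w 0 from hw)]
  · have hz1 : z 0 = 0 := by
      obtain ⟨O, _, rfl⟩ := hD
      exact le_antisymm (not_lt.1 hz0) hz.2
    obtain ⟨y, rfl⟩ : ∃ y, z = bdPoint y := ⟨bdPart z, by
      ext i
      refine Fin.cases ?_ (fun i => ?_) i
      · simpa [bdPoint] using hz1
      · simp [bdPoint, bdPart]⟩
    have hy : y ∈ bdSlice D := hz
    have hac : ContinuousAt (fun w : Coord d => a (bdPart w)) (bdPoint y) := by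
      refine ContinuousAt.comp (g := a) ?_ contDiff_bdPart.continuous.continuousAt
      rw [bdPart_bdPoint]
      exact (ha.contDiffAt (hD.isOpen_bdSlice.mem_nhds hy)).continuousAt
    -- The extension is `a(y)` plus a function that is `f - a` inside and `0` elsewhere, which tends
    -- to zero.
    have hdiff : Tendsto (fun w : Coord d => if 0 < w 0 then f w - a (bdPart w) else 0)
        (𝓝 (bdPoint y)) (𝓝 0) :=
      Tendsto.if ((hlead y hy).tendsto_zero (by norm_num)) tendsto_const_nhds
    have hsum := hdiff.add hac
    rw [ContinuousWithinAt, if_neg hz0]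
    rw [zero_add] at hsum
    refine (hsum.congr fun w => ?_).mono_left nhdsWithin_le_nhds
    split_ifs <;> simp

/-- The terms with `k ≥ n` have order `n - 1/2` whatever their logarithms; the others cancel on the
open set `W`. -/
theorem HasPhgExpansion.conormal_sub (hD : IsRelOpen D) (hD' : IsRelOpen D')
    (h : HasPhgExpansion D f a) (h' : HasPhgExpansion D' f' a') {W : Set (BdCoord d)}
    (hW : IsOpen W) (hWD : W ⊆ bdSlice D) (hWD' : W ⊆ bdSlice D') {n : ℤ}
    (heq : ∀ k < n, ∀ q, EqOn (a k q) (a' k q) W) (hy : y ∈ W) :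
    Conormal (n - 1 / 2) y (fun z => f z - f' z) := by
  obtain ⟨k₀, P, h0, hc⟩ := h.exists_conormal hD
  obtain ⟨k₀', P', h0', hc'⟩ := h'.exists_conormal hD'
  have h1 := ((hc n y (hWD hy)).sub (hc' n y (hWD' hy))).mono (r' := n - 1 / 2) (by linarith)
  have h2 := conormal_phgSum (r := n - 1 / 2) (k₀ := min k₀ k₀') (N := max n n)
    (P := fun k => max (P k) (P' k)) (a := fun k p y => a k p y - a' k p y) hW hy
    (fun k p => ((h.2.1 k p).mono hWD).sub ((h'.2.1 k p).mono hWD')) fun k _ p => by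
      rcases lt_or_ge k n with hk | hk
      · exact Or.inl fun y hy => sub_eq_zero.2 (heq k hk p hy)
      · have : (n : ℝ) ≤ k := by exact_mod_cast hk
        exact Or.inr (Or.inl (by linarith))
  refine (h1.add h2).congr ?_
  filter_upwards [eventually_bdPart_mem hW hy] with z hz
  rw [← phgSum_sub_phgSum (fun k p _ hk => h0 k p (by omega) _ (hWD hz))
    (fun k p _ hk => h0' k p (by omega) _ (hWD' hz))]
  ring

/-- An integer `k < n` lies below `n - 1/2`, so uniqueness applies to the difference of the two
partial sums. -/
theorem HasPhgExpansion.coeff_eq (hD : IsRelOpen D) (hD' : IsRelOpen D')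
    (h : HasPhgExpansion D f a) (h' : HasPhgExpansion D' f' a')
    (hy : y ∈ bdSlice D) (hy' : y ∈ bdSlice D') {n : ℤ}
    (hff : Conormal (n - 1 / 2) y (fun z => f z - f' z)) {k : ℤ} (hk : k < n) (q : ℕ) :
    a k q y = a' k q y := by
  obtain ⟨k₀, P, h0, hc⟩ := h.exists_conormal hD
  obtain ⟨k₀', P', h0', hc'⟩ := h'.exists_conormal hD'
  have h1 := ((hc n y hy).sub (hc' n y hy')).mono (r' := n - 1 / 2) (by linarith)
  have h2 := ((hff.sub h1).isBigO).comp_tendsto (tendsto_linePoint y)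
  have h3 : (fun x : ℝ => phgSum (min k₀ k₀') (fun k => max (P k) (P' k))
      (fun k p y => a k p y - a' k p y) (max n n) (linePoint y x)) =O[𝓝[>] 0]
      fun x => x ^ ((n : ℝ) - 1 / 2) := by
    refine h2.congr_left fun x => ?_
    rw [← phgSum_sub_phgSum
      (fun k p _ hk => by rw [bdPart_linePoint]; exact h0 k p (by omega) _ hy)
      (fun k p _ hk => by rw [bdPart_linePoint]; exact h0' k p (by omega) _ hy')]
    simp only [Function.comp]
    ring
  have hkn : (k : ℝ) + 1 ≤ n := by exact_mod_cast hk
  refine sub_eq_zero.1 (coeff_eq_zero_of_phgSum_isBigO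
    (a := fun k p y => a k p y - a' k p y) h3 (fun k p _ hk => ?_) (k := k) (by omega)
    (by linarith) (p := q) (Or.inl (by linarith)))
  rw [h0 k p (by omega) y hy, h0' k p (by omega) y hy', sub_zero]

end Expansions

/-! ### Curvature in the frame `x ∂_s` -/

section Curvature

variable {d : ℕ}

/-- A relation between functions on `U` and functions on `U'` that is compatible with the ring
operations and with the vector fields `x ∂_s`. -/
structure IsFrameRelation (U U' : Set (Coord d))
    (Q : (Coord d → ℝ) → (Coord d → ℝ) → Prop) : Prop where
  isOpen : IsOpen U
  isOpen' : IsOpen U'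
  pos : U ⊆ posHalf d
  pos' : U' ⊆ posHalf d
  smooth : ∀ {f f'}, Q f f' → ContDiffOn ℝ ∞ f U
  smooth' : ∀ {f f'}, Q f f' → ContDiffOn ℝ ∞ f' U'
  congr : ∀ {f f' g g'}, Q f f' → EqOn f g U → EqOn f' g' U' → Q g g'
  const : ∀ c, Q (fun _ => c) (fun _ => c)
  add : ∀ {f f' g g'}, Q f f' → Q g g' → Q (fun z => f z + g z) (fun z => f' z + g' z)
  mul : ∀ {f f' g g'}, Q f f' → Q g g' → Q (fun z => f z * g z) (fun z => f' z * g' z)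
  zeroDeriv : ∀ {f f'}, Q f f' → ∀ s, Q (zeroDeriv s f) (zeroDeriv s f')

/-- `x^q T` and `x^q T'` are related. -/
def Weighted (Q : (Coord d → ℝ) → (Coord d → ℝ) → Prop) (q : ℤ) (T T' : Coord d → ℝ) : Prop :=
  Q (fun z => z 0 ^ q * T z) (fun z => z 0 ^ q * T' z)

/-- The product rule behind the weights: a coordinate derivative raises the weight by one and costs
only `x∂_s` and a constant multiple. -/
theorem zeroDeriv_zpow_mul {U : Set (Coord d)} (hU : IsOpen U) (hpos : U ⊆ posHalf d)
    {T : Coord d → ℝ} {q : ℤ} (hT : ContDiffOn ℝ ∞ (fun z => z 0 ^ q * T z) U) (s : Fin (d + 1))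
    {z : Coord d} (hz : z ∈ U) :
    zeroDeriv s (fun z => z 0 ^ q * T z) z + (if s = 0 then -q else 0 : ℝ) * (z 0 ^ q * T z) =
      z 0 ^ (q + 1) * pd s T z := by
  have hz0 : 0 < z 0 := hpos hz
  have hp : ∀ k : ℤ, HasDerivAt (fun x : ℝ => x ^ k) (k * z 0 ^ (k - 1)) (z 0) := fun k =>
    hasDerivAt_zpow k (z 0) (Or.inl hz0.ne')
  have hpd : ∀ k : ℤ, DifferentiableAt ℝ (fun w : Coord d => w 0 ^ k) z := fun k =>
    DifferentiableAt.comp (g := fun x : ℝ => x ^ k) z (hp k).differentiableAt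
      (differentiableAt_of_smooth (contDiffAt_coord 0))
  -- `T` is recovered as `x^(-q)` times the smooth function `x^q T`.
  have hTd : DifferentiableAt ℝ T z := by
    refine ((hpd (-q)).mul
      (differentiableAt_of_smooth (hT.contDiffAt (hU.mem_nhds hz)))).congr_of_eventuallyEq ?_
    filter_upwards [hU.mem_nhds hz] with w hw
    have hw0 : 0 < w 0 := hpos hw
    simp only [Pi.mul_apply, zpow_neg]
    field_simp
  rw [zeroDeriv_eq, bDeriv_mul s (hpd q) hTd, bDeriv_comp_coord_zero s (hp q),
    zpow_add_one₀ hz0.ne', bDeriv]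
  split_ifs with hs
  · rw [zpow_sub_one₀ hz0.ne', hs]
    field_simp
    ring
  · ring

namespace IsFrameRelation

variable {U U' : Set (Coord d)} {Q : (Coord d → ℝ) → (Coord d → ℝ) → Prop}
  {T T' S S' : Coord d → ℝ} {p q : ℤ}

theorem neg (hQ : IsFrameRelation U U' Q) (h : Q T T') :
    Q (fun z => -T z) (fun z => -T' z) := by
  simpa using hQ.mul (hQ.const (-1)) h

theorem sum (hQ : IsFrameRelation U U' Q) {ι : Type*} (s : Finset ι)
    {F F' : ι → Coord d → ℝ} (h : ∀ i ∈ s, Q (F i) (F' i)) :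
    Q (fun z => ∑ i ∈ s, F i z) (fun z => ∑ i ∈ s, F' i z) := by
  classical
  induction s using Finset.induction_on with
  | empty => simpa using hQ.const 0
  | insert i s hi ih =>
    simp only [Finset.sum_insert hi]
    exact hQ.add (h i (by simp)) (ih fun j hj => h j (by simp [hj]))

theorem prod (hQ : IsFrameRelation U U' Q) {ι : Type*} (s : Finset ι)
    {F F' : ι → Coord d → ℝ} (h : ∀ i ∈ s, Q (F i) (F' i)) :
    Q (fun z => ∏ i ∈ s, F i z) (fun z => ∏ i ∈ s, F' i z) := by
  classical
  induction s using Finset.induction_on with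
  | empty => simpa using hQ.const 1
  | insert i s hi ih =>
    simp only [Finset.prod_insert hi]
    exact hQ.mul (h i (by simp)) (ih fun j hj => h j (by simp [hj]))

theorem det (hQ : IsFrameRelation U U' Q) {H H' : CoordMetric d}
    (h : ∀ s t, Q (fun z => H z s t) (fun z => H' z s t)) :
    Q (fun z => (H z).det) (fun z => (H' z).det) := by
  simp only [Matrix.det_apply']
  exact hQ.sum _ fun σ _ => hQ.mul (hQ.const _) (hQ.prod _ fun i _ => h _ _)

/-- Cramer's rule: the adjugate entries are determinants of row-updated matrices, so the reciprocal
determinant is the only further input. -/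
theorem inv (hQ : IsFrameRelation U U' Q) {H H' : CoordMetric d}
    (h : ∀ s t, Q (fun z => H z s t) (fun z => H' z s t))
    (hdet : Q (fun z => ((H z).det)⁻¹) (fun z => ((H' z).det)⁻¹)) (s t : Fin (d + 1)) :
    Q (fun z => (H z)⁻¹ s t) (fun z => (H' z)⁻¹ s t) := by
  simp only [Matrix.inv_def, Matrix.smul_apply, smul_eq_mul, Ring.inverse_eq_inv',
    Matrix.adjugate_apply]
  refine hQ.mul hdet (hQ.det fun i j => ?_)
  by_cases hi : i = t
  · subst hi
    simpa only [Matrix.updateRow_self] using hQ.const _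
  · simpa only [Matrix.updateRow_ne hi] using h i j

/-! ### The calculus of weights -/

theorem weighted_zero (h : Q T T') : Weighted Q 0 T T' := by
  simpa [Weighted] using h

theorem weighted_add (hQ : IsFrameRelation U U' Q) (h : Weighted Q q T T')
    (h' : Weighted Q q S S') : Weighted Q q (fun z => T z + S z) (fun z => T' z + S' z) := by
  simpa only [Weighted, mul_add] using hQ.add h h'

theorem weighted_neg (hQ : IsFrameRelation U U' Q) (h : Weighted Q q T T') :
    Weighted Q q (fun z => -T z) (fun z => -T' z) := by
  simpa only [Weighted, mul_neg] using hQ.neg h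

theorem weighted_sub (hQ : IsFrameRelation U U' Q) (h : Weighted Q q T T')
    (h' : Weighted Q q S S') : Weighted Q q (fun z => T z - S z) (fun z => T' z - S' z) := by
  simpa only [sub_eq_add_neg] using hQ.weighted_add h (hQ.weighted_neg h')

theorem weighted_sum (hQ : IsFrameRelation U U' Q) {ι : Type*} (s : Finset ι)
    {F F' : ι → Coord d → ℝ} (h : ∀ i ∈ s, Weighted Q q (F i) (F' i)) :
    Weighted Q q (fun z => ∑ i ∈ s, F i z) (fun z => ∑ i ∈ s, F' i z) := by
  simpa only [Weighted, Finset.mul_sum] using hQ.sum s h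

theorem weighted_mul (hQ : IsFrameRelation U U' Q) (h : Weighted Q p T T')
    (h' : Weighted Q q S S') :
    Weighted Q (p + q) (fun z => T z * S z) (fun z => T' z * S' z) := by
  have key : ∀ (T S : Coord d → ℝ) (z : Coord d), 0 < z 0 →
      z 0 ^ p * T z * (z 0 ^ q * S z) = z 0 ^ (p + q) * (T z * S z) := fun T S z hz => by
    rw [zpow_add₀ hz.ne']; ring
  exact hQ.congr (hQ.mul h h') (fun z hz => key T S z (hQ.pos hz))
    (fun z hz => key T' S' z (hQ.pos' hz))

theorem weighted_const_mul (hQ : IsFrameRelation U U' Q) (h : Weighted Q q T T') (c : ℝ) :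
    Weighted Q q (fun z => c * T z) (fun z => c * T' z) := by
  simpa using hQ.weighted_mul (weighted_zero (hQ.const c)) h

theorem weighted_prod (hQ : IsFrameRelation U U' Q) {ι : Type*} (s : Finset ι) {w : ι → ℤ}
    {F F' : ι → Coord d → ℝ} (h : ∀ i ∈ s, Weighted Q (w i) (F i) (F' i)) :
    Weighted Q (∑ i ∈ s, w i) (fun z => ∏ i ∈ s, F i z) (fun z => ∏ i ∈ s, F' i z) := by
  classical
  induction s using Finset.induction_on with
  | empty => simpa using weighted_zero (hQ.const 1)
  | insert i s hi ih =>
    simp only [Finset.prod_insert hi, Finset.sum_insert hi]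
    exact hQ.weighted_mul (h i (by simp)) (ih fun j hj => h j (by simp [hj]))

theorem weighted_pd (hQ : IsFrameRelation U U' Q) (h : Weighted Q q T T') (s : Fin (d + 1)) :
    Weighted Q (q + 1) (pd s T) (pd s T') :=
  hQ.congr (hQ.add (hQ.zeroDeriv h s) (hQ.mul (hQ.const (if s = 0 then -q else 0 : ℝ)) h))
    (fun _ hz => zeroDeriv_zpow_mul hQ.isOpen hQ.pos (hQ.smooth h) s hz)
    (fun _ hz => zeroDeriv_zpow_mul hQ.isOpen' hQ.pos' (hQ.smooth' h) s hz)

variable {G G' : CoordMetric d}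

/-- The weight is `-2` from the inverse metric plus `2 + 1` from a derivative of the metric. -/
theorem weighted_christoffel (hQ : IsFrameRelation U U' Q)
    (hG : ∀ s t, Weighted Q 2 (fun z => G z s t) (fun z => G' z s t))
    (hGi : ∀ s t, Weighted Q (-2) (fun z => (G z)⁻¹ s t) (fun z => (G' z)⁻¹ s t))
    (k i j : Fin (d + 1)) : Weighted Q 1 (christoffel G k i j) (christoffel G' k i j) :=
  hQ.weighted_const_mul (hQ.weighted_sum _ fun l _ => hQ.weighted_mul (q := 3) (hGi k l)
    (hQ.weighted_sub (hQ.weighted_add (hQ.weighted_pd (hG j l) i) (hQ.weighted_pd (hG i l) j))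
      (hQ.weighted_pd (hG i j) l))) (1 / 2)

theorem weighted_riemann (hQ : IsFrameRelation U U' Q)
    (hG : ∀ s t, Weighted Q 2 (fun z => G z s t) (fun z => G' z s t))
    (hGi : ∀ s t, Weighted Q (-2) (fun z => (G z)⁻¹ s t) (fun z => (G' z)⁻¹ s t))
    (I : Fin 4 → Fin (d + 1)) : Weighted Q 4 (riemann G I) (riemann G' I) := by
  have hΓ := hQ.weighted_christoffel hG hGi
  have hup : ∀ s t u v, Weighted Q 2 (riemannUp G s t u v) (riemannUp G' s t u v) :=
    fun s t u v => hQ.weighted_add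
      (hQ.weighted_sub (hQ.weighted_pd (hΓ s v t) u) (hQ.weighted_pd (hΓ s u t) v))
      (hQ.weighted_sum _ fun w _ => hQ.weighted_sub (hQ.weighted_mul (hΓ s u w) (hΓ w v t))
        (hQ.weighted_mul (hΓ s v w) (hΓ w u t)))
  exact hQ.weighted_sum _ fun w _ => hQ.weighted_mul (p := 2) (q := 2) (hG _ w) (hup w _ _ _)

theorem weighted_covDeriv (hQ : IsFrameRelation U U' Q)
    (hG : ∀ s t, Weighted Q 2 (fun z => G z s t) (fun z => G' z s t))
    (hGi : ∀ s t, Weighted Q (-2) (fun z => (G z)⁻¹ s t) (fun z => (G' z)⁻¹ s t))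
    {q : ℕ} {A A' : CoordTensor d q} (hA : ∀ I, Weighted Q q (A I) (A' I))
    (I : Fin (q + 1) → Fin (d + 1)) :
    Weighted Q (q + 1 : ℕ) (covDeriv G A I) (covDeriv G' A' I) := by
  have hΓ := hQ.weighted_christoffel hG hGi
  push_cast
  refine hQ.weighted_sub (hQ.weighted_pd (hA _) _) (hQ.weighted_sum _ fun j _ =>
    hQ.weighted_sum _ fun β _ => ?_)
  rw [add_comm]
  exact hQ.weighted_mul (hΓ _ _ _) (hA _)

theorem weighted_curvatureJet (hQ : IsFrameRelation U U' Q)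
    (hG : ∀ s t, Weighted Q 2 (fun z => G z s t) (fun z => G' z s t))
    (hGi : ∀ s t, Weighted Q (-2) (fun z => (G z)⁻¹ s t) (fun z => (G' z)⁻¹ s t))
    (p : ℕ) (I : Fin (4 + p) → Fin (d + 1)) :
    Weighted Q (4 + p : ℕ) (curvatureJet G p I) (curvatureJet G' p I) := by
  induction p with
  | zero => exact hQ.weighted_riemann hG hGi I
  | succ p ih => exact hQ.weighted_covDeriv hG hGi ih I

/-- Each raised index contributes a factor of weight `-2`, which accounts for the exponent `q -
2|S|` of the frame component. -/
theorem frameComponent (hQ : IsFrameRelation U U' Q)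
    (hGi : ∀ s t, Weighted Q (-2) (fun z => (G z)⁻¹ s t) (fun z => (G' z)⁻¹ s t))
    {q : ℕ} {A A' : CoordTensor d q} (hA : ∀ I, Weighted Q q (A I) (A' I))
    (S : Finset (Fin q)) (I : Fin q → Fin (d + 1)) :
    Q (frameComponent G A S I) (AsympHyp.frameComponent G' A' S I) := by
  have hw : ∑ j : Fin q, (if j ∈ S then -2 else 0 : ℤ) = -2 * (S.card : ℤ) := by
    simp [Finset.sum_ite_mem, mul_comm]
  have hsum : ∀ J : Fin q → Fin (d + 1), Weighted Q ((q : ℤ) - 2 * (S.card : ℤ))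
      (fun z => (∏ j, if j ∈ S then (G z)⁻¹ (I j) (J j) else if I j = J j then 1 else 0) * A J z)
      (fun z => (∏ j, if j ∈ S then (G' z)⁻¹ (I j) (J j) else if I j = J j then 1 else 0) *
        A' J z) := fun J => by
    have he : (q : ℤ) - 2 * (S.card : ℤ) = ∑ j : Fin q, (if j ∈ S then -2 else 0 : ℤ) + q := by
      rw [hw]; ring
    rw [he]
    refine hQ.weighted_mul (hQ.weighted_prod _ fun j _ => ?_) (hA J)
    split_ifs
    · exact hGi _ _
    · exact weighted_zero (hQ.const 1)
    · exact weighted_zero (hQ.const 0)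
  exact hQ.weighted_sum _ fun J _ => hsum J

/-- The frame components of the derivatives of the curvature of `G = x⁻² H` are related if the
entries of `H` and the inverse of its determinant are. -/
theorem curvature (hQ : IsFrameRelation U U' Q) {H H' : CoordMetric d}
    (hGH : ∀ z ∈ U, H z = z 0 ^ 2 • G z) (hGH' : ∀ z ∈ U', H' z = z 0 ^ 2 • G' z)
    (h : ∀ s t, Q (fun z => H z s t) (fun z => H' z s t))
    (hdet : Q (fun z => ((H z).det)⁻¹) (fun z => ((H' z).det)⁻¹))
    (hU : ∀ z ∈ U, (H z).det ≠ 0) (hU' : ∀ z ∈ U', (H' z).det ≠ 0)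
    (p : ℕ) (S : Finset (Fin (4 + p))) (I : Fin (4 + p) → Fin (d + 1)) :
    Q (AsympHyp.frameComponent G (curvatureJet G p) S I)
      (AsympHyp.frameComponent G' (curvatureJet G' p) S I) := by
  have hG : ∀ s t, Weighted Q 2 (fun z => G z s t) (fun z => G' z s t) := fun s t =>
    hQ.congr (h s t) (fun z hz => by simp [hGH z hz])
      (fun z hz => by simp [hGH' z hz])
  have key : ∀ (G H : CoordMetric d) (z : Coord d), 0 < z 0 → H z = z 0 ^ 2 • G z →
      (H z).det ≠ 0 → ∀ s t, (H z)⁻¹ s t = z 0 ^ (-2 : ℤ) * (G z)⁻¹ s t := by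
    intro G H z hz hGH hH s t
    have hdG : IsUnit (G z).det := by
      rw [hGH, Matrix.det_smul] at hH
      exact isUnit_iff_ne_zero.2 (right_ne_zero_of_mul hH)
    have hinv : (H z)⁻¹ = (z 0 ^ 2)⁻¹ • (G z)⁻¹ := by
      refine Matrix.inv_eq_right_inv ?_
      rw [hGH, Matrix.smul_mul, Matrix.mul_smul, smul_smul, mul_inv_cancel₀ (by positivity),
        one_smul, Matrix.mul_nonsing_inv _ hdG]
    rw [hinv, Matrix.smul_apply, smul_eq_mul, zpow_neg]
    norm_cast
  have hGi : ∀ s t, Weighted Q (-2) (fun z => (G z)⁻¹ s t) (fun z => (G' z)⁻¹ s t) := fun s t =>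
    hQ.congr (hQ.inv h hdet s t)
      (fun z hz => key G H z (hQ.pos hz) (hGH z hz) (hU z hz) s t)
      (fun z hz => key G' H' z (hQ.pos' hz) (hGH' z hz) (hU' z hz) s t)
  exact hQ.frameComponent hGi (hQ.weighted_curvatureJet hG hGi p) S I

end IsFrameRelation

end Curvature

/-! ### Adapted charts -/

section Charts

variable {d : ℕ} {M : Type*} [TopologicalSpace M]

theorem mem_chartDomain {φ : OpenPartialHomeomorph M (EuclideanHalfSpace (d + 1))} {z : Coord d} :
    z ∈ chartDomain φ ↔ ∃ h : 0 ≤ z 0, (⟨z, h⟩ : EuclideanHalfSpace (d + 1)) ∈ φ.target := by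
  constructor
  · intro hz
    rw [chartDomain, OpenPartialHomeomorph.extend_target] at hz
    obtain ⟨h1, ⟨w, rfl⟩⟩ := hz
    exact ⟨w.2, (congrArg (· ∈ φ.target) ((𝓡∂ (d + 1)).left_inv w)).mp h1⟩
  · rintro ⟨h, hz⟩
    rw [chartDomain, OpenPartialHomeomorph.extend_target]
    refine ⟨?_, ⟨⟨z, h⟩, rfl⟩⟩
    have : (𝓡∂ (d + 1)).symm ((𝓡∂ (d + 1)) (⟨z, h⟩ : EuclideanHalfSpace (d + 1))) = ⟨z, h⟩ :=
      (𝓡∂ (d + 1)).left_inv _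
    exact (congrArg (· ∈ φ.target) this).mpr hz

theorem isRelOpen_chartDomain (φ : OpenPartialHomeomorph M (EuclideanHalfSpace (d + 1))) :
    IsRelOpen (chartDomain φ) := by
  obtain ⟨O, hO, hOt⟩ := isOpen_induced_iff.1 φ.open_target
  refine ⟨O, hO, ?_⟩
  ext z
  rw [mem_chartDomain]
  simp only [← hOt, mem_inter_iff, mem_preimage]
  exact ⟨fun ⟨h, hz⟩ => ⟨hz, h⟩, fun ⟨hz, h⟩ => ⟨h, hz⟩⟩

namespace ConformallyCompactMetric

variable [ChartedSpace (EuclideanHalfSpace (d + 1)) M] [IsManifold (𝓡∂ (d + 1)) ∞ M]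
  {X : ConformallyCompactMetric d M} {φ : OpenPartialHomeomorph M (EuclideanHalfSpace (d + 1))}

theorem IsAdaptedChart.x_symm (hφ : X.IsAdaptedChart φ) {z : Coord d} (hz : z ∈ chartDomain φ) :
    X.x ((φ.extend (𝓡∂ (d + 1))).symm z) = z 0 := by
  obtain ⟨h, ht⟩ := mem_chartDomain.1 hz
  have hsrc := (φ.extend (𝓡∂ (d + 1))).map_target hz
  have h1 := (φ.extend (𝓡∂ (d + 1))).right_inv hz
  rw [OpenPartialHomeomorph.extend_source] at hsrc
  rw [← hφ.coord_zero _ hsrc]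
  exact congrArg (fun w : Coord d => w 0) h1

theorem IsAdaptedChart.gbarComp_eq (hφ : X.IsAdaptedChart φ) {z : Coord d}
    (hz : z ∈ chartDomain φ ∩ posHalf d) : X.gbarComp φ z = z 0 ^ 2 • X.gComp φ z := by
  have hx := hφ.x_symm hz.1
  -- Interiority is deduced from `x`, which vanishes on the boundary but equals `z 0 > 0` here.
  have hint : (φ.extend (𝓡∂ (d + 1))).symm z ∈ (𝓡∂ (d + 1)).interior M := by
    by_contra hcon
    have hb : (φ.extend (𝓡∂ (d + 1))).symm z ∈ (𝓡∂ (d + 1)).boundary M := by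
      rw [← ModelWithCorners.compl_interior]
      exact hcon
    have h0 := X.x_zero _ hb
    rw [hx] at h0
    exact (show 0 < z 0 from hz.2).ne' h0
  ext s t
  have h := X.gbar_eq _ hint (coordVector φ z s) (coordVector φ z t)
  rw [hx] at h
  exact h

/-- The derivative of the inverse of an adapted chart is injective. -/
theorem IsAdaptedChart.injective_mfderivWithin (hφ : X.IsAdaptedChart φ) {z : Coord d}
    (hz : z ∈ chartDomain φ) :
    Function.Injective (mfderivWithin 𝓘(ℝ, Coord d) (𝓡∂ (d + 1)) (φ.extend (𝓡∂ (d + 1))).symm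
      (range (𝓡∂ (d + 1))) z) := by
  obtain ⟨h, ht⟩ := mem_chartDomain.1 hz
  have hzr : z ∈ range (𝓡∂ (d + 1)) := ⟨⟨z, h⟩, rfl⟩
  have hIz : (𝓡∂ (d + 1)).symm z = ⟨z, h⟩ := (𝓡∂ (d + 1)).left_inv ⟨z, h⟩
  have hsrc : (φ.extend (𝓡∂ (d + 1))).symm z ∈ φ.source := by
    have := (φ.extend (𝓡∂ (d + 1))).map_target hz
    rwa [OpenPartialHomeomorph.extend_source] at this
  have h1 : MDifferentiableWithinAt 𝓘(ℝ, Coord d) (𝓡∂ (d + 1)) (φ.extend (𝓡∂ (d + 1))).symm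
      (range (𝓡∂ (d + 1))) z := by
    have hI : MDifferentiableWithinAt 𝓘(ℝ, Coord d) (𝓡∂ (d + 1)) (𝓡∂ (d + 1)).symm
        (range (𝓡∂ (d + 1))) z :=
      ((𝓡∂ (d + 1)).contMDiffOn_symm (n := 1) z hzr).mdifferentiableWithinAt one_ne_zero
    have hs : MDifferentiableAt (𝓡∂ (d + 1)) (𝓡∂ (d + 1)) φ.symm ((𝓡∂ (d + 1)).symm z) := by
      rw [hIz]
      exact (hφ.C1_symm.contMDiffAt (φ.open_target.mem_nhds ht)).mdifferentiableAt one_ne_zero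
    exact hs.comp_mdifferentiableWithinAt z hI
  have h2 : MDifferentiableAt (𝓡∂ (d + 1)) 𝓘(ℝ, Coord d) (φ.extend (𝓡∂ (d + 1)))
      ((φ.extend (𝓡∂ (d + 1))).symm z) := by
    have hI : MDifferentiableAt (𝓡∂ (d + 1)) 𝓘(ℝ, Coord d) (𝓡∂ (d + 1))
        (φ ((φ.extend (𝓡∂ (d + 1))).symm z)) :=
      ((𝓡∂ (d + 1)).contMDiff (n := 1)).contMDiffAt.mdifferentiableAt one_ne_zero
    exact hI.comp _
      ((hφ.C1.contMDiffAt (φ.open_source.mem_nhds hsrc)).mdifferentiableAt one_ne_zero)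
  have hu : UniqueMDiffWithinAt 𝓘(ℝ, Coord d) (range (𝓡∂ (d + 1))) z :=
    ((𝓡∂ (d + 1)).uniqueDiffOn z hzr).uniqueMDiffWithinAt
  have hcomp := mfderiv_comp_mfderivWithin z h2 h1 hu
  have hid : mfderivWithin 𝓘(ℝ, Coord d) 𝓘(ℝ, Coord d)
      (φ.extend (𝓡∂ (d + 1)) ∘ (φ.extend (𝓡∂ (d + 1))).symm) (range (𝓡∂ (d + 1))) z =
      ContinuousLinearMap.id ℝ (TangentSpace 𝓘(ℝ, Coord d) z) := by
    rw [← mfderivWithin_id hu]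
    refine Filter.EventuallyEq.mfderivWithin_eq ?_ ((φ.extend (𝓡∂ (d + 1))).right_inv hz)
    have ht := φ.extend_target_mem_nhdsWithin (I := 𝓡∂ (d + 1)) hsrc
    rw [(φ.extend (𝓡∂ (d + 1))).right_inv hz] at ht
    filter_upwards [ht] with w hw
    exact (φ.extend (𝓡∂ (d + 1))).right_inv hw
  intro v w hvw
  have := congrArg (mfderiv (𝓡∂ (d + 1)) 𝓘(ℝ, Coord d) (φ.extend (𝓡∂ (d + 1)))
      ((φ.extend (𝓡∂ (d + 1))).symm z)) hvw
  rw [← ContinuousLinearMap.comp_apply, ← ContinuousLinearMap.comp_apply, ← hcomp, hid] at this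
  exact this

/-- A null vector of the Gram matrix would give a tangent vector of zero `ḡ`-length, nonzero by
injectivity of the derivative. The argument includes boundary points. -/
theorem IsAdaptedChart.det_gbarComp_ne_zero (hφ : X.IsAdaptedChart φ) {z : Coord d}
    (hz : z ∈ chartDomain φ) : (X.gbarComp φ z).det ≠ 0 := by
  intro hdet
  obtain ⟨v, hv, hHv⟩ := Matrix.exists_mulVec_eq_zero_iff.2 hdet
  obtain ⟨L, hL, hLinj⟩ : ∃ L : Coord d →L[ℝ]
      TangentSpace (𝓡∂ (d + 1)) ((φ.extend (𝓡∂ (d + 1))).symm z),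
      (∀ s, coordVector φ z s = L (EuclideanSpace.single s (1 : ℝ))) ∧ Function.Injective L :=
    ⟨mfderivWithin 𝓘(ℝ, Coord d) (𝓡∂ (d + 1)) (φ.extend (𝓡∂ (d + 1))).symm
      (range (𝓡∂ (d + 1))) z, fun _ => rfl, hφ.injective_mfderivWithin hz⟩
  set w : TangentSpace (𝓡∂ (d + 1)) ((φ.extend (𝓡∂ (d + 1))).symm z) :=
    ∑ s, v s • coordVector φ z s with hw
  have hLw : w = L (∑ s, v s • (EuclideanSpace.single s (1 : ℝ) : Coord d)) := by
    rw [hw, map_sum]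
    refine Finset.sum_congr rfl fun s _ => ?_
    rw [map_smul, hL]
  have hsum : ∑ s, v s • (EuclideanSpace.single s (1 : ℝ) : Coord d) = WithLp.toLp 2 v := by
    ext i
    simp [Finset.sum_apply, Pi.single_apply]
  have hw0 : w ≠ 0 := by
    intro h0
    rw [hLw, hsum] at h0
    have h1 : (WithLp.toLp 2 v : Coord d) = 0 :=
      hLinj (h0.trans (map_zero L).symm)
    exact hv (by simpa using congrArg WithLp.ofLp h1)
  have hpos := X.gbar.pos _ w hw0
  have hzero : X.gbar.inner _ w w = ∑ s, v s * (X.gbarComp φ z).mulVec v s := by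
    rw [hw]
    simp only [map_sum, map_smul, _root_.sum_apply, _root_.smul_apply,
      smul_eq_mul, Matrix.mulVec, dotProduct, Finset.mul_sum]
    rw [Finset.sum_comm]
    refine Finset.sum_congr rfl fun s _ => Finset.sum_congr rfl fun t _ => ?_
    simp only [gbarComp, coordMetric, Matrix.of_apply]
    ring
  rw [hHv] at hzero
  simp only [Pi.zero_apply, mul_zero, Finset.sum_const_zero] at hzero
  exact hpos.ne' hzero

end ConformallyCompactMetric

end Charts

/-! ### The expansion of the curvature -/

section Main

variable {d : ℕ} {y : BdCoord d} {D D' : Set (Coord d)} {f : Coord d → ℝ} {H : CoordMetric d}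

theorem contDiffOn_zeroDeriv {U : Set (Coord d)} (hU : IsOpen U) (hf : ContDiffOn ℝ ∞ f U)
    (s : Fin (d + 1)) : ContDiffOn ℝ ∞ (zeroDeriv s f) U := fun _ hz =>
  ((contDiffAt_coord 0).mul
    (contDiffAt_pd (hf.contDiffAt (hU.mem_nhds hz)) s)).contDiffWithinAt

theorem IsRelOpen.tendsto_bdFilter (hD : IsRelOpen D) (hf : ContinuousOn f D)
    (hy : y ∈ bdSlice D) : Tendsto f (bdFilter y) (𝓝 (f (bdPoint y))) := by
  have h := hf (bdPoint y) hy
  refine h.mono_left (le_inf (bdFilter_le y) (le_principal_iff.2 ?_))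
  filter_upwards [hD.eventually_mem hy] with z hz using hz.1

/-- `f` is smooth in the interior and polyhomogeneous and bounded at the boundary. -/
def IsSmoothPhg (D : Set (Coord d)) (f : Coord d → ℝ) : Prop :=
  ContDiffOn ℝ ∞ f (D ∩ posHalf d) ∧ IsBoundedPhg (bdSlice D) f

theorem IsSmoothPhg.congr {g : Coord d → ℝ} (hD : IsRelOpen D) (hf : IsSmoothPhg D f)
    (h : EqOn f g (D ∩ posHalf d)) : IsSmoothPhg D g :=
  ⟨hf.1.congr fun _ hz => (h hz).symm, hf.2.congr fun y hy => by
    filter_upwards [hD.eventually_mem hy] with z hz using h hz⟩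

/-- A class of functions viewed as a relation, for use with one metric in both places. -/
theorem isFrameRelation_isSmoothPhg (hD : IsRelOpen D) :
    IsFrameRelation (D ∩ posHalf d) (D ∩ posHalf d)
      (fun f f' => IsSmoothPhg D f ∧ IsSmoothPhg D f') where
  isOpen := hD.isOpen_inter
  isOpen' := hD.isOpen_inter
  pos := inter_subset_right
  pos' := inter_subset_right
  smooth h := h.1.1
  smooth' h := h.2.1
  congr h h1 h2 := ⟨h.1.congr hD h1, h.2.congr hD h2⟩
  const c := ⟨⟨contDiffOn_const, isBoundedPhg_const c⟩, ⟨contDiffOn_const, isBoundedPhg_const c⟩⟩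
  add h h' := ⟨⟨h.1.1.add h'.1.1, h.1.2.add h'.1.2⟩, ⟨h.2.1.add h'.2.1, h.2.2.add h'.2.2⟩⟩
  mul h h' := ⟨⟨h.1.1.mul h'.1.1, h.1.2.mul hD.isOpen_bdSlice h'.1.2⟩,
    ⟨h.2.1.mul h'.2.1, h.2.2.mul hD.isOpen_bdSlice h'.2.2⟩⟩
  zeroDeriv h s := ⟨⟨contDiffOn_zeroDeriv hD.isOpen_inter h.1.1 s,
    h.1.2.zeroDeriv hD.isOpen_bdSlice s⟩, ⟨contDiffOn_zeroDeriv hD.isOpen_inter h.2.1 s,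
    h.2.2.zeroDeriv hD.isOpen_bdSlice s⟩⟩

theorem isSmoothPhg_det (hD : IsRelOpen D) (hH : ∀ s t, IsSmoothPhg D (fun z => H z s t)) :
    IsSmoothPhg D (fun z => (H z).det) :=
  ((isFrameRelation_isSmoothPhg hD).det fun s t => ⟨hH s t, hH s t⟩).1

theorem isSmoothPhg_det_inv (hD : IsRelOpen D) (hH : ∀ s t, IsSmoothPhg D (fun z => H z s t))
    (hcont : ∀ s t, ContinuousOn (fun z => H z s t) D) (hdet : ∀ z ∈ D, (H z).det ≠ 0) :
    IsSmoothPhg D (fun z => ((H z).det)⁻¹) := by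
  have h := isSmoothPhg_det hD hH
  have hc : ContinuousOn (fun z => (H z).det) D := by
    simp only [Matrix.det_apply']
    exact continuousOn_finsetSum _ fun σ _ =>
      continuousOn_const.mul (continuousOn_finsetProd _ fun i _ => hcont _ _)
  exact ⟨h.1.inv fun _ hz => hdet _ hz.1, h.2.inv hD.isOpen_bdSlice fun y hy =>
    ⟨_, hdet _ hy, hD.tendsto_bdFilter hc hy⟩⟩

theorem HasPhgExpansion.isSmoothPhg (hD : IsRelOpen D) {a : ℤ → ℕ → BdCoord d → ℝ}
    (h : HasPhgExpansion D f a) (hf : ContinuousOn f D) : IsSmoothPhg D f :=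
  ⟨h.1, h.isBoundedPhg hD fun _ hy => (hD.tendsto_bdFilter hf hy).isBigO_one ℝ⟩

/-- `f` and `f'` are smooth in the interior and conormal at `W`, and they agree at `W` to the
order `r`. -/
def AgreeToOrder (U U' : Set (Coord d)) (W : Set (BdCoord d)) (r : ℝ) (f f' : Coord d → ℝ) :
    Prop :=
  ContDiffOn ℝ ∞ f U ∧ ContDiffOn ℝ ∞ f' U' ∧
    ∀ y ∈ W, Conormal 0 y f ∧ Conormal 0 y f' ∧ Conormal r y (fun z => f z - f' z)

/-- Products are compatible because `f g - f' g' = f (g - g') + (f - f') g'`; this is why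
conormality of order `0` is part of the relation. -/
theorem isFrameRelation_agreeToOrder (hD : IsRelOpen D) (hD' : IsRelOpen D')
    {W : Set (BdCoord d)} (hW : W ⊆ bdSlice D) (hW' : W ⊆ bdSlice D') (r : ℝ) :
    IsFrameRelation (D ∩ posHalf d) (D' ∩ posHalf d)
      (AgreeToOrder (D ∩ posHalf d) (D' ∩ posHalf d) W r) where
  isOpen := hD.isOpen_inter
  isOpen' := hD'.isOpen_inter
  pos := inter_subset_right
  pos' := inter_subset_right
  smooth h := h.1
  smooth' h := h.2.1
  congr h h1 h2 := by
    refine ⟨h.1.congr fun z hz => (h1 hz).symm, h.2.1.congr fun z hz => (h2 hz).symm,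
      fun y hy => ?_⟩
    obtain ⟨hf, hf', hff⟩ := h.2.2 y hy
    have e1 := (hD.eventually_mem (hW hy)).mono fun z hz => h1 hz
    have e2 := (hD'.eventually_mem (hW' hy)).mono fun z hz => h2 hz
    refine ⟨hf.congr e1, hf'.congr e2, hff.congr ?_⟩
    filter_upwards [e1, e2] with z h1 h2
    rw [h1, h2]
  const c := ⟨contDiffOn_const, contDiffOn_const, fun y _ => ⟨conormal_const le_rfl c,
    conormal_const le_rfl c, by simpa using conormal_zero⟩⟩
  add h h' := by
    refine ⟨h.1.add h'.1, h.2.1.add h'.2.1, fun y hy => ?_⟩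
    obtain ⟨hf, hf', hff⟩ := h.2.2 y hy
    obtain ⟨hg, hg', hgg⟩ := h'.2.2 y hy
    exact ⟨hf.add hg, hf'.add hg', (hff.add hgg).congr (Eventually.of_forall fun z => by
      dsimp only; ring)⟩
  mul h h' := by
    refine ⟨h.1.mul h'.1, h.2.1.mul h'.2.1, fun y hy => ?_⟩
    obtain ⟨hf, hf', hff⟩ := h.2.2 y hy
    obtain ⟨hg, hg', hgg⟩ := h'.2.2 y hy
    refine ⟨by simpa using hf.mul hg, by simpa using hf'.mul hg', ?_⟩
    have h1 := hf.mul hgg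
    have h2 := hff.mul hg'
    rw [zero_add] at h1
    rw [add_zero] at h2
    exact (h1.add h2).congr (Eventually.of_forall fun z => by dsimp only; ring)
  zeroDeriv h s := by
    refine ⟨contDiffOn_zeroDeriv hD.isOpen_inter h.1 s,
      contDiffOn_zeroDeriv hD'.isOpen_inter h.2.1 s, fun y hy => ?_⟩
    obtain ⟨hf, hf', hff⟩ := h.2.2 y hy
    refine ⟨hf.zeroDeriv s, hf'.zeroDeriv s, (hff.zeroDeriv s).congr ?_⟩
    filter_upwards [hf.smooth, hf'.smooth] with z h1 h2
    exact zeroDeriv_sub s (differentiableAt_of_smooth h1) (differentiableAt_of_smooth h2)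

end Main

end AsympHyp

end

theorem mainTheorem7 {d : ℕ} {M : Type*} [TopologicalSpace M] [T2Space M] [CompactSpace M]
    [ChartedSpace (EuclideanHalfSpace (d + 1)) M] [IsManifold (𝓡∂ (d + 1)) ∞ M]
    (X : AsympHyp.ConformallyCompactMetric d M)
    (hX : X.IsAsymptoticallyHyperbolic) (hx : X.IsSpecial)
    (φ : OpenPartialHomeomorph M (EuclideanHalfSpace (d + 1))) (hφ : X.IsAdaptedChart φ)
    (hcont : ∀ s t, ContinuousOn (fun z => X.gbarComp φ z s t) (AsympHyp.chartDomain φ))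
    (hphg : ∀ s t, AsympHyp.IsPhg (AsympHyp.chartDomain φ) (fun z => X.gbarComp φ z s t)) :
    (∀ (p : ℕ) (S : Finset (Fin (4 + p))) (I : Fin (4 + p) → Fin (d + 1)),
      AsympHyp.IsPhg (AsympHyp.chartDomain φ) (X.curvatureComp φ p S I) ∧
      AsympHyp.ExtendsContinuously (AsympHyp.chartDomain φ) (X.curvatureComp φ p S I)) ∧
    (∀ {M' : Type*} [TopologicalSpace M'] [T2Space M'] [CompactSpace M']
      [ChartedSpace (EuclideanHalfSpace (d + 1)) M'] [IsManifold (𝓡∂ (d + 1)) ∞ M']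
      (X' : AsympHyp.ConformallyCompactMetric d M')
      (_ : X'.IsAsymptoticallyHyperbolic) (_ : X'.IsSpecial)
      (φ' : OpenPartialHomeomorph M' (EuclideanHalfSpace (d + 1))) (_ : X'.IsAdaptedChart φ')
      (_ : ∀ s t, ContinuousOn (fun z => X'.gbarComp φ' z s t) (AsympHyp.chartDomain φ'))
      (a a' : Fin (d + 1) → Fin (d + 1) → ℤ → ℕ → AsympHyp.BdCoord d → ℝ)
      (_ : ∀ s t, AsympHyp.HasPhgExpansion (AsympHyp.chartDomain φ)
        (fun z => X.gbarComp φ z s t) (a s t))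
      (_ : ∀ s t, AsympHyp.HasPhgExpansion (AsympHyp.chartDomain φ')
        (fun z => X'.gbarComp φ' z s t) (a' s t))
      (W : Set (AsympHyp.BdCoord d)) (_ : IsOpen W)
      (_ : W ⊆ AsympHyp.bdSlice (AsympHyp.chartDomain φ))
      (_ : W ⊆ AsympHyp.bdSlice (AsympHyp.chartDomain φ'))
      (n : ℤ) (_ : ∀ s t, ∀ k < n, ∀ q, EqOn (a s t k q) (a' s t k q) W)
      (p : ℕ) (S : Finset (Fin (4 + p))) (I : Fin (4 + p) → Fin (d + 1))
      (b b' : ℤ → ℕ → AsympHyp.BdCoord d → ℝ)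
      (_ : AsympHyp.HasPhgExpansion (AsympHyp.chartDomain φ) (X.curvatureComp φ p S I) b)
      (_ : AsympHyp.HasPhgExpansion (AsympHyp.chartDomain φ') (X'.curvatureComp φ' p S I) b'),
      ∀ k < n, ∀ q, EqOn (b k q) (b' k q) W) := by
  have hD := AsympHyp.isRelOpen_chartDomain φ
  have hH : ∀ s t, AsympHyp.IsSmoothPhg (AsympHyp.chartDomain φ) (fun z => X.gbarComp φ z s t) :=
    fun s t => (hphg s t).elim fun _ h => h.isSmoothPhg hD (hcont s t)
  have hdet := AsympHyp.isSmoothPhg_det_inv hD hH hcont fun _ hz => hφ.det_gbarComp_ne_zero hz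
  have hmain : ∀ (p : ℕ) (S : Finset (Fin (4 + p))) (I : Fin (4 + p) → Fin (d + 1)),
      AsympHyp.IsSmoothPhg (AsympHyp.chartDomain φ) (X.curvatureComp φ p S I) := fun p S I =>
    ((AsympHyp.isFrameRelation_isSmoothPhg hD).curvature (fun _ hz => hφ.gbarComp_eq hz)
      (fun _ hz => hφ.gbarComp_eq hz) (fun s t => ⟨hH s t, hH s t⟩) ⟨hdet, hdet⟩
      (fun _ hz => hφ.det_gbarComp_ne_zero hz.1) (fun _ hz => hφ.det_gbarComp_ne_zero hz.1)
      p S I).1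
  refine ⟨fun p S I => ⟨(hmain p S I).2.isPhg hD (hmain p S I).1,
    (hmain p S I).2.extendsContinuously hD (hmain p S I).1⟩, ?_⟩
  intro M' _ _ _ _ _ X' _ _ φ' hφ' hcont' a a' ha ha' W hW hWD hWD' n hn p S I b b' hb hb' k hk q
    y hy
  have hD' := AsympHyp.isRelOpen_chartDomain φ'
  have hH' : ∀ s t, AsympHyp.IsSmoothPhg (AsympHyp.chartDomain φ')
      (fun z => X'.gbarComp φ' z s t) := fun s t => (ha' s t).isSmoothPhg hD' (hcont' s t)
  have hdet' := AsympHyp.isSmoothPhg_det_inv hD' hH' hcont' fun _ hz =>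
    hφ'.det_gbarComp_ne_zero hz
  have hQ := AsympHyp.isFrameRelation_agreeToOrder hD hD' hWD hWD' ((n : ℝ) - 1 / 2)
  have hHH : ∀ s t, AsympHyp.AgreeToOrder (AsympHyp.chartDomain φ ∩ AsympHyp.posHalf d)
      (AsympHyp.chartDomain φ' ∩ AsympHyp.posHalf d) W ((n : ℝ) - 1 / 2)
      (fun z => X.gbarComp φ z s t) (fun z => X'.gbarComp φ' z s t) := fun s t =>
    ⟨(hH s t).1, (hH' s t).1, fun y hy => ⟨(hH s t).2.conormal hD.isOpen_bdSlice (hWD hy),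
      (hH' s t).2.conormal hD'.isOpen_bdSlice (hWD' hy),
      (ha s t).conormal_sub hD hD' (ha' s t) hW hWD hWD' (hn s t) hy⟩⟩
  have hdd : AsympHyp.AgreeToOrder (AsympHyp.chartDomain φ ∩ AsympHyp.posHalf d)
      (AsympHyp.chartDomain φ' ∩ AsympHyp.posHalf d) W ((n : ℝ) - 1 / 2)
      (fun z => ((X.gbarComp φ z).det)⁻¹) (fun z => ((X'.gbarComp φ' z).det)⁻¹) := by
    refine ⟨hdet.1, hdet'.1, fun y hy => ?_⟩
    have hi := hdet.2.conormal hD.isOpen_bdSlice (hWD hy)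
    have hi' := hdet'.2.conormal hD'.isOpen_bdSlice (hWD' hy)
    refine ⟨hi, hi', ?_⟩
    -- For the determinants `δ, δ'`: `1/δ - 1/δ' = -(δ - δ') · (1/δ) · (1/δ')`, with reciprocals
    -- conormal of order `0`.
    have h := ((hQ.det hHH).2.2 y hy).2.2.neg.mul (hi.mul hi')
    rw [add_zero, add_zero] at h
    refine h.congr ?_
    filter_upwards [hD.eventually_mem (hWD hy), hD'.eventually_mem (hWD' hy)] with z hz hz'
    have h1 := hφ.det_gbarComp_ne_zero hz.1
    have h2 := hφ'.det_gbarComp_ne_zero hz'.1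
    field_simp
    ring
  exact hb.coeff_eq hD hD' hb' (hWD hy) (hWD' hy)
    ((hQ.curvature (fun _ hz => hφ.gbarComp_eq hz) (fun _ hz => hφ'.gbarComp_eq hz) hHH hdd
      (fun _ hz => hφ.det_gbarComp_ne_zero hz.1) (fun _ hz => hφ'.det_gbarComp_ne_zero hz.1)
      p S I).2.2 y hy).2.2 hk q
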